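/- For a polynomial $f$ over $\mathbb{F}_2$ in $n$ variables, let $\operatorname{gap}(f)=\sum_{x\in\{0,1\}^n}(-1)^{f(x)}=|\{x:f(x)=0\}|-|\{x:f(x)=1\}|$. Here $f$ is given explicitly as the number $n$ together with the list of its terms, which are distinct products of distinct variables. It is \#P-hard to compute $\operatorname{gap}(f)$, even when the input is restricted to polynomials $f$ of degree $3$ in which every variable appears in at most $3$ terms. That is, let $F:\{0,1\}^*\to\mathbb{N}$ be any function in \#P, meaning that from $w\in\{0,1\}^*$ one can compute in polynomial time a Boolean circuit $C_w$ of AND, OR and NOT gates with one output bit such that $F(w)=|\{x:C_w(x)=1\}|$. Then there are a polynomial-time computable map $R$ sending each $w\in\{0,1\}^*$ to such a restricted polynomial $R(w)$, and a polynomial-time computable map $S:\{0,1\}^*\times\mathbb{Z}\to\mathbb{N}$ (integers written in binary), such that $F(w)=S(w,\operatorname{gap}(R(w)))$ for all $w$. -/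

import Mathlib

/-! ### Binary encodings -/

/-- Self-delimiting unary code of a natural number: `k` ones followed by a zero. -/
def encUnary (k : ℕ) : List Bool := List.replicate k true ++ [false]

/-- Self-delimiting code of a list of self-delimiting items: every item is preceded by a one,
and the list is closed by a zero. -/
def encList {α : Type} (e : α → List Bool) (l : List α) : List Bool :=
  l.flatMap (fun a => true :: e a) ++ [false]

/-- Binary code of an integer: a sign bit, then the absolute value in binary. -/
def encInt (z : ℤ) : List Bool := decide (z < 0) :: Computability.encodeNat z.natAbs

/-- Code of a pair consisting of a bit string and an integer. -/
def encStringInt (p : List Bool × ℤ) : List Bool := encList (fun b => [b]) p.1 ++ encInt p.2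

/-- `f` is computable in polynomial time (by a deterministic multi-stack Turing machine) with
respect to the given encodings by bit strings of its arguments and its values. -/
def PolyTime {α β : Type} (ea : α → List Bool) (eb : β → List Bool) (f : α → β) : Prop :=
  Nonempty (Turing.TM2ComputableInPolyTime ea eb f)

/-! ### Boolean circuits and the class `#P` -/

/-- A gate of a Boolean circuit; its arguments are the numbers of the wires it reads. -/
inductive Gate : Type
  | and (i j : ℕ)
  | or (i j : ℕ)
  | not (i : ℕ)

namespace Gate

/-- All wires read by the gate have a number less than `m`. -/
def ReadsBelow (m : ℕ) : Gate → Prop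
  | and i j => i < m ∧ j < m
  | or i j => i < m ∧ j < m
  | not i => i < m

/-- The output bit of a gate, given the values of all wires. -/
def eval (v : ℕ → Bool) : Gate → Bool
  | and i j => v i && v j
  | or i j => v i || v j
  | not i => !(v i)

def encode : Gate → List Bool
  | and i j => true :: true :: (encUnary i ++ encUnary j)
  | or i j => true :: false :: (encUnary i ++ encUnary j)
  | not i => false :: encUnary i

end Gate

/-- A Boolean circuit with one output bit. The wires `0, …, numInputs - 1` carry the input bits,
and wire `numInputs + k` carries the output of gate number `k`, which may only read wires with
smaller numbers. -/
structure Circuit : Type where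
  numInputs : ℕ
  gates : List Gate
  output : ℕ
  gates_wf : ∀ (k : ℕ) (hk : k < gates.length), (gates[k]).ReadsBelow (numInputs + k)
  output_wf : output < numInputs + gates.length

namespace Circuit

/-- The list of the values of all wires of the circuit on input `x`. -/
def wires (C : Circuit) (x : Fin C.numInputs → Bool) : List Bool :=
  C.gates.foldl (fun v g => v ++ [g.eval (fun i => v.getD i false)]) (List.ofFn x)

/-- The output bit of the circuit on input `x`. -/
def eval (C : Circuit) (x : Fin C.numInputs → Bool) : Bool := (C.wires x).getD C.output false

/-- Circuit Counting: the number of inputs on which the circuit outputs `1`. -/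
def count (C : Circuit) : ℕ := Fintype.card {x : Fin C.numInputs → Bool // C.eval x = true}

def encode (C : Circuit) : List Bool :=
  encUnary C.numInputs ++ (encList Gate.encode C.gates ++ encUnary C.output)

end Circuit

/-- The class `#P`: functions `f` that can be expressed as Circuit Counting, i.e. a circuit with
exactly `f x` satisfying inputs can be produced from `x` in polynomial time. -/
def InSharpP (f : List Bool → ℕ) : Prop :=
  ∃ C : List Bool → Circuit, PolyTime id Circuit.encode C ∧ ∀ x, f x = (C x).count

/-- The problem of computing the integer `g a`, given an instance `a` (encoded by `enc a`), is
`#P`-hard: every function `f` in `#P` reduces to it in polynomial time. From `x` one computes an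
instance `R x`, and from `x` and the answer `g (R x)` (written in binary) one computes `f x` (in
binary), both in polynomial time. -/
def SharpPHard {I : Type} (enc : I → List Bool) (g : I → ℤ) : Prop :=
  ∀ f : List Bool → ℕ, InSharpP f →
    ∃ (R : List Bool → I) (S : List Bool × ℤ → ℕ),
      PolyTime id enc R ∧ PolyTime encStringInt Computability.encodeNat S ∧
        ∀ x, f x = S (x, g (R x))

/-! ### Polynomials over the field with two elements -/

/-- The gap of a polynomial `p` in `n` variables over `𝔽₂`: the sum of `(-1) ^ p(x)` over all
`x ∈ {0,1}ⁿ`, i.e. the number of zeroes of `p` minus the number of ones of `p`. -/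
noncomputable def gap {n : ℕ} (p : MvPolynomial (Fin n) (ZMod 2)) : ℤ :=
  ∑ x : Fin n → ZMod 2, (-1) ^ (MvPolynomial.eval x p).val

/-- The number of terms of `p` in which the variable `i` appears. -/
noncomputable def numTermsWith {n : ℕ} (p : MvPolynomial (Fin n) (ZMod 2)) (i : Fin n) : ℕ :=
  (p.support.filter (fun m => m i ≠ 0)).card

/-- A multilinear polynomial over `𝔽₂`, written out as a list of its (pairwise distinct) terms,
each of which is a product of distinct variables. -/
structure PolyF2 : Type where
  numVars : ℕ
  terms : List (Finset (Fin numVars))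
  terms_nodup : terms.Nodup

namespace PolyF2

/-- The polynomial that is the sum of the listed terms. -/
noncomputable def toPoly (P : PolyF2) : MvPolynomial (Fin P.numVars) (ZMod 2) :=
  (P.terms.map (fun t => ∏ i ∈ t, MvPolynomial.X i)).sum

/-- The code of a polynomial: the number of variables in unary, then the list of the terms, each
as the increasing list of its variables, with indices in unary. -/
def encode (P : PolyF2) : List Bool :=
  encUnary P.numVars ++
    encList (fun t => encList (fun i : Fin P.numVars => encUnary i) (t.sort (· ≤ ·))) P.terms

end PolyF2

/-- Degree-3 polynomials over `𝔽₂` in which each variable appears in at most three terms. -/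
def CubicThreeTerms : Type :=
  {P : PolyF2 // P.toPoly.totalDegree = 3 ∧ ∀ i, numTermsWith P.toPoly i ≤ 3}

/-! The variables are arranged in rows of equal width `w`. Every term contains exactly one variable
from an even row: a quadratic term joins vertically adjacent variables, and a cubic term has its
factors in rows 4k+1, 4k+2, 4k+3. The exponent is thus linear in the even rows, and summing over
them leaves a power of two times the number of assignments of the odd rows for which all
coefficients of even-row variables vanish (`sum_sgn_linear`).

These coefficients express a computation over 𝔽₂ (`constraints_iff_valid`). Row 4k+1 holds the
columns before instruction k; row 4k+2 forces row 4k+3 to be the result of adding a product of two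
columns to a third; row 4k+4 forces row 4k+5 to be a copy of row 4k+3. Thanks to the copy, each
variable lies in at most one cubic term besides its links to the row above and the row below, hence
in at most three terms. The links are shifted by c = `numInputs + 2` columns: initially c columns
are free and the others are zero, and at the end those c columns must be zero. An assignment is
determined by its initial columns (`card_valid`).

Column 0 plays the constant one, column 1 is a dummy u, and the next columns hold the input x. The
instructions evaluate the circuit, copy its output to a fresh column, multiply the columns 1, …, c-1
by 1 + column 0, and finally add the output to column 0. If column 0 starts as 1, the run ends in
zero exactly when the circuit accepts x, with u arbitrary. If it starts as 0, the erasure does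
nothing, so all free columns must be zero, and the zero vector does work. Altogether 2·`count` + 1
vectors are counted (`card_good`). The gap is a power of two times this odd number, so `count` is
half its odd part, whatever the power is.

For the running time, a small language of stack programs is compiled to machine code that runs after
a given machine (`PolyTime.andThen`). One program writes the polynomial from the code of the
circuit. Another one extracts the count by deleting bits from the binary code of the gap. -/

/-! ### A structured language of stack programs -/

/-- Programs acting on finitely many stacks of bits, named by `H`. -/
inductive Cmd (H : Type) : Type
  /-- do nothing -/
  | skip
  /-- push a bit -/
  | push (k : H) (b : Bool)
  /-- sequential composition -/
  | seq (c₁ c₂ : Cmd H)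
  /-- pop a stack and continue according to the result -/
  | branch (k : H) (body : Option Bool → Cmd H)
  /-- pop a stack; if this yields a bit that passes the test, run the body and repeat -/
  | loop (k : H) (test : Bool → Bool) (body : Bool → Cmd H)

namespace Cmd

open Function (update)

/-- `Runs c s s' n`: started with the stacks `s`, the program `c` ends with the stacks `s'` after
`n` steps. -/
inductive Runs {H : Type} [DecidableEq H] :
    Cmd H → (H → List Bool) → (H → List Bool) → ℕ → Prop
  | skip (s) : Runs skip s s 1
  | push (k b s) : Runs (push k b) s (update s k (b :: s k)) 1
  | seq {c₁ c₂ s s₁ s₂ n₁ n₂} : Runs c₁ s s₁ n₁ → Runs c₂ s₁ s₂ n₂ →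
      Runs (seq c₁ c₂) s s₂ (n₁ + n₂)
  | branch {k body s s' n} : Runs (body (s k).head?) (update s k (s k).tail) s' n →
      Runs (branch k body) s s' (1 + n)
  | loop_done {k test body s} : (∀ b, (s k).head? = some b → test b = false) →
      Runs (loop k test body) s (update s k (s k).tail) 1
  | loop_step {k test body s b s₁ s₂ n₁ n₂} : (s k).head? = some b → test b = true →
      Runs (body b) (update s k (s k).tail) s₁ n₁ → Runs (loop k test body) s₁ s₂ n₂ →
      Runs (loop k test body) s s₂ (1 + (n₁ + n₂))

/-- The labels of the machine code of a program. -/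
def Lab {H : Type} : Cmd H → Type
  | skip => Unit
  | push _ _ => Unit
  | seq c₁ c₂ => c₁.Lab ⊕ c₂.Lab
  | branch _ body => Unit ⊕ (Σ o : Option Bool, (body o).Lab)
  | loop _ _ body => Unit ⊕ (Σ b : Bool, (body b).Lab)

noncomputable instance Lab.fintype {H : Type} : (c : Cmd H) → Fintype c.Lab
  | skip => inferInstanceAs (Fintype Unit)
  | push _ _ => inferInstanceAs (Fintype Unit)
  | seq c₁ c₂ =>
    have := Lab.fintype c₁
    have := Lab.fintype c₂
    inferInstanceAs (Fintype (c₁.Lab ⊕ c₂.Lab))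
  | branch _ body =>
    have := fun o => Lab.fintype (body o)
    inferInstanceAs (Fintype (Unit ⊕ (Σ o : Option Bool, (body o).Lab)))
  | loop _ _ body =>
    have := fun o => Lab.fintype (body o)
    inferInstanceAs (Fintype (Unit ⊕ (Σ b : Bool, (body b).Lab)))

/-- The label at which the machine code of a program starts. -/
def entry {H : Type} : (c : Cmd H) → c.Lab
  | skip => ()
  | push _ _ => ()
  | seq c₁ _ => Sum.inl c₁.entry
  | branch _ _ => Sum.inl ()
  | loop _ _ _ => Sum.inl ()

end Cmd

/-! ### Running a program on the output of a machine -/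

namespace Turing.FinTM2

open Function (update)
open Turing.TM2 (stepAux)

variable (M : FinTM2) (J : Type)

/-- The stack alphabets of the machine `M` with additional stacks of bits. -/
abbrev ExtΓ : M.K ⊕ J → Type
  | .inl k => M.Γ k
  | .inr _ => Bool

/-- The internal states of the machine `M` with an additional register. -/
abbrev ExtState : Type := M.σ × Option Bool

variable {M J}

/-- A statement of `M` as a statement of an extended machine that jumps to `exit` instead of
halting. -/
def liftStmt {Λ : Type} (emb : M.Λ → Λ) (exit : Λ) :
    TM2.Stmt M.Γ M.Λ M.σ → TM2.Stmt (M.ExtΓ J) Λ M.ExtState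
  | .push k f q => .push (.inl k) (fun v => f v.1) (liftStmt emb exit q)
  | .peek k f q => .peek (.inl k) (fun v a => (f v.1 a, v.2)) (liftStmt emb exit q)
  | .pop k f q => .pop (.inl k) (fun v a => (f v.1 a, v.2)) (liftStmt emb exit q)
  | .load f q => .load (fun v => (f v.1, v.2)) (liftStmt emb exit q)
  | .branch f q₁ q₂ => .branch (fun v => f v.1) (liftStmt emb exit q₁) (liftStmt emb exit q₂)
  | .goto f => .goto (fun v => emb (f v.1))
  | .halt => .goto (fun _ => exit)

/-- The stacks of `M` with additional empty stacks. -/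
def extStk (S : ∀ k, List (M.Γ k)) : ∀ k, List (M.ExtΓ J k)
  | .inl k => S k
  | .inr _ => []

/-- A configuration of `M` as a configuration of an extended machine. -/
def liftCfg {Λ : Type} (emb : M.Λ → Λ) (exit : Λ) (c : TM2.Cfg M.Γ M.Λ M.σ) :
    TM2.Cfg (M.ExtΓ J) Λ M.ExtState :=
  ⟨some (c.l.elim exit emb), (c.var, none), extStk c.stk⟩

theorem extStk_update [DecidableEq J] (S : ∀ k, List (M.Γ k)) (k : M.K) (l : List (M.Γ k)) :
    (extStk (J := J) (update S k l)) = update (extStk S) (Sum.inl k) l := by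
  funext k'
  by_cases hk : k' = Sum.inl k
  · subst hk
    rw [Function.update_self]
    exact Function.update_self ..
  · rw [Function.update_of_ne hk]
    rcases k' with k' | j
    · exact Function.update_of_ne (fun h => hk (by rw [h])) ..
    · rfl

/-- A lifted statement touches neither the additional stacks nor the register, so these keep their
initial values during the whole first phase. -/
theorem stepAux_liftStmt [DecidableEq J] {Λ : Type} (emb : M.Λ → Λ) (exit : Λ)
    (q : TM2.Stmt M.Γ M.Λ M.σ) (v : M.σ) (S : ∀ k, List (M.Γ k)) :
    stepAux (liftStmt (J := J) emb exit q) (v, none) (extStk S) =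
      liftCfg emb exit (stepAux q v S) := by
  induction q generalizing v S with
  | push k f q ih => rw [liftStmt, stepAux, TM2.stepAux.eq_1, ← ih, extStk_update]; rfl
  | peek k f q ih => rw [liftStmt, stepAux, TM2.stepAux.eq_2, ← ih]; rfl
  | pop k f q ih => rw [liftStmt, stepAux, TM2.stepAux.eq_3, ← ih, extStk_update]; rfl
  | load f q ih => rw [liftStmt, stepAux, TM2.stepAux.eq_4, ← ih]
  | branch f q₁ q₂ ih₁ ih₂ =>
    rw [liftStmt, stepAux, TM2.stepAux.eq_5]
    cases f v
    · simpa using ih₂ v S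
    · simpa using ih₁ v S
  | goto f => rfl
  | halt => rfl

/-- The stack named by a handle: the output stack of `M` or one of the additional stacks. -/
def handle (k : M.K) : Option J → M.K ⊕ J
  | none => .inl k
  | some j => .inr j

/-- The alphabet of the stack named by a handle. -/
def handleAlphabet {k : M.K} (e : M.Γ k ≃ Bool) :
    (h : Option J) → M.ExtΓ J (handle k h) ≃ Bool
  | none => e
  | some _ => Equiv.refl Bool

/-- The stacks of the extended machine with given contents for all handles. -/
def handleStk {k : M.K} (e : M.Γ k ≃ Bool) (s : Option J → List Bool) :
    ∀ k, List (M.ExtΓ J k)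
  | .inl k' => update (fun _ => []) k ((s none).map e.symm) k'
  | .inr j => s (some j)

theorem handleStk_handle {k : M.K} (e : M.Γ k ≃ Bool) (s : Option J → List Bool) (h : Option J) :
    handleStk e s (handle k h) = (s h).map (handleAlphabet e h).symm := by
  cases h with
  | none => exact Function.update_self (f := fun k => ([] : List (M.Γ k))) ..
  | some j => exact (List.map_id _).symm

theorem handleStk_update [DecidableEq J] {k : M.K} (e : M.Γ k ≃ Bool) (s : Option J → List Bool)
    (h : Option J) (l : List Bool) :
    handleStk e (update s h l) =
      update (handleStk e s) (handle k h) (l.map (handleAlphabet e h).symm) := by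
  funext k'
  by_cases hk : k' = handle k h
  · subst hk
    rw [Function.update_self, handleStk_handle, Function.update_self]
  · rw [Function.update_of_ne hk]
    rcases k' with k' | j
    · by_cases hn : h = none
      · subst hn
        have : k' ≠ k := fun h' => hk (by rw [h']; rfl)
        simp only [handleStk]
        rw [Function.update_of_ne this, Function.update_of_ne this]
      · simp only [handleStk]
        rw [Function.update_of_ne (Ne.symm hn)]
    · exact Function.update_of_ne (fun h' => hk (by rw [← h']; rfl)) ..

variable [DecidableEq J] {k₁ : M.K} (e : M.Γ k₁ ≃ Bool)

/-- Push a bit on the stack named by a handle. -/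
def pushStmt {Λ : Type} (h : Option J) (b : Bool) (q : TM2.Stmt (M.ExtΓ J) Λ M.ExtState) :
    TM2.Stmt (M.ExtΓ J) Λ M.ExtState :=
  .push (handle k₁ h) (fun _ => (handleAlphabet e h).symm b) q

/-- Pop the stack named by a handle into the register. -/
def popStmt {Λ : Type} (h : Option J) (q : TM2.Stmt (M.ExtΓ J) Λ M.ExtState) :
    TM2.Stmt (M.ExtΓ J) Λ M.ExtState :=
  .pop (handle k₁ h) (fun v a => (v.1, a.map (handleAlphabet e h))) q

theorem stepAux_pushStmt {Λ : Type} (h : Option J) (b : Bool)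
    (q : TM2.Stmt (M.ExtΓ J) Λ M.ExtState) (v : M.ExtState) (s : Option J → List Bool) :
    stepAux (pushStmt e h b q) v (handleStk e s) =
      stepAux q v (handleStk e (update s h (b :: s h))) := by
  rw [pushStmt, stepAux, handleStk_update, handleStk_handle, List.map_cons]

theorem stepAux_popStmt {Λ : Type} (h : Option J)
    (q : TM2.Stmt (M.ExtΓ J) Λ M.ExtState) (v : M.ExtState) (s : Option J → List Bool) :
    stepAux (popStmt e h q) v (handleStk e s) =
      stepAux q (v.1, (s h).head?) (handleStk e (update s h (s h).tail)) := by
  rw [popStmt, stepAux, handleStk_update, handleStk_handle, List.head?_map, List.map_tail]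
  simp [Option.map_map, Function.comp_def]

/-- The machine code of a program. -/
def code {Λ : Type} : (c : Cmd (Option J)) → (c.Lab → Λ) → Λ → c.Lab →
    TM2.Stmt (M.ExtΓ J) Λ M.ExtState
  | .skip, _, exit, _ => .goto fun _ => exit
  | .push h b, _, exit, _ => pushStmt e h b (.goto fun _ => exit)
  | .seq c₁ c₂, emb, _, .inl l => code c₁ (fun l => emb (.inl l)) (emb (.inr c₂.entry)) l
  | .seq _ c₂, emb, exit, .inr l => code c₂ (fun l => emb (.inr l)) exit l
  | .branch h body, emb, _, .inl _ =>
      popStmt e h (.goto fun v => emb (.inr ⟨v.2, (body v.2).entry⟩))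
  | .branch _ body, emb, exit, .inr ⟨o, l⟩ => code (body o) (fun l => emb (.inr ⟨o, l⟩)) exit l
  | .loop h test body, emb, exit, .inl _ =>
      popStmt e h (.goto fun v =>
        v.2.elim exit fun b => bif test b then emb (.inr ⟨b, (body b).entry⟩) else exit)
  | .loop _ _ body, emb, _, .inr ⟨b, l⟩ =>
      code (body b) (fun l => emb (.inr ⟨b, l⟩)) (emb (.inl ())) l

end Turing.FinTM2

/-! ### Exact step counts of a transition function -/

namespace StateTransition

/-- `f` leads from `a` to `b` in exactly `n` steps. -/
def Steps {σ : Type*} (f : σ → Option σ) (n : ℕ) (a b : σ) : Prop :=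
  (flip bind f)^[n] (some a) = some b

theorem Steps.refl {σ : Type*} (f : σ → Option σ) (a : σ) : Steps f 0 a a := rfl

theorem Steps.one {σ : Type*} {f : σ → Option σ} {a b : σ} (h : f a = some b) :
    Steps f 1 a b := h

theorem Steps.trans {σ : Type*} {f : σ → Option σ} {m n : ℕ} {a b c : σ} (h₁ : Steps f m a b)
    (h₂ : Steps f n b c) : Steps f (m + n) a c := by
  rw [Steps, Nat.add_comm, Function.iterate_add_apply, h₁, h₂]

theorem iterate_bind_none {σ : Type*} (f : σ → Option σ) (n : ℕ) :
    (flip bind f)^[n] none = none := by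
  induction n with
  | zero => rfl
  | succ n ih => rw [Function.iterate_succ_apply]; exact ih

theorem Steps.head {σ : Type*} {f : σ → Option σ} {n : ℕ} {a c : σ} (h : Steps f (n + 1) a c) :
    ∃ b, f a = some b ∧ Steps f n b c := by
  rw [Steps, Function.iterate_succ_apply] at h
  change (flip bind f)^[n] (f a) = _ at h
  cases hb : f a with
  | none => rw [hb, iterate_bind_none] at h; cases h
  | some b => exact ⟨b, rfl, by rw [hb] at h; exact h⟩

end StateTransition

/-! ### Correctness of the machine code and growth of the stacks -/

namespace Turing.FinTM2

open Function (update)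
open Turing.TM2 (stepAux)
open StateTransition (Steps)

variable {M : FinTM2} {J : Type} [DecidableEq J] {k₁ : M.K} (e : M.Γ k₁ ≃ Bool)

theorem step_of_eq {K Λ σ : Type} [DecidableEq K] {Γ : K → Type} {m : Λ → TM2.Stmt Γ Λ σ}
    {l : Λ} {q : TM2.Stmt Γ Λ σ} (h : m l = q) {v : σ} {S : ∀ k, List (Γ k)} {c : TM2.Cfg Γ Λ σ}
    (hc : stepAux q v S = c) : TM2.step m ⟨some l, v, S⟩ = some c := by
  rw [TM2.step, h, hc]

/-- Each unit charged by `Runs` is one machine step, so the count is exact. Quantifying over `emb`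
and `exit` lets the induction place subprograms inside larger code. The initial register is
arbitrary because it is read only directly after a pop has overwritten it. -/
theorem steps_code {Λ : Type} (m : Λ → TM2.Stmt (M.ExtΓ J) Λ M.ExtState) {c : Cmd (Option J)}
    {s s' : Option J → List Bool} {n : ℕ} (h : c.Runs s s' n) :
    ∀ (emb : c.Lab → Λ) (exit : Λ), (∀ l, m (emb l) = code e c emb exit l) →
    ∀ v : M.ExtState, ∃ v' : M.ExtState,
      Steps (TM2.step m) n ⟨some (emb c.entry), v, handleStk e s⟩
        ⟨some exit, v', handleStk e s'⟩ := by
  induction h with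
  | skip s =>
    intro emb exit hm v
    exact ⟨v, Steps.one (step_of_eq (hm _) rfl)⟩
  | push k b s =>
    intro emb exit hm v
    exact ⟨v, Steps.one (step_of_eq (hm _) (stepAux_pushStmt e ..))⟩
  | @seq c₁ c₂ s s₁ s₂ n₁ n₂ _ _ ih₁ ih₂ =>
    intro emb exit hm v
    obtain ⟨v₁, h₁⟩ := ih₁ (fun l => emb (.inl l)) (emb (.inr c₂.entry)) (fun l => hm (.inl l)) v
    obtain ⟨v₂, h₂⟩ := ih₂ (fun l => emb (.inr l)) exit (fun l => hm (.inr l)) v₁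
    exact ⟨v₂, h₁.trans h₂⟩
  | @branch k body s s' n _ ih =>
    intro emb exit hm v
    obtain ⟨v₁, h₁⟩ := ih (fun l => emb (.inr ⟨_, l⟩)) exit (fun l => hm (.inr ⟨_, l⟩))
      (v.1, (s k).head?)
    exact ⟨v₁, Steps.trans (Steps.one (step_of_eq (hm (.inl ())) (stepAux_popStmt e ..))) h₁⟩
  | @loop_done k test body s hd =>
    intro emb exit hm v
    refine ⟨(v.1, (s k).head?),
      Steps.one (step_of_eq (hm (.inl ())) ((stepAux_popStmt e ..).trans ?_))⟩
    rw [stepAux]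
    cases hs : (s k).head? with
    | none => rfl
    | some b => simp [hd b hs]
  | @loop_step k test body s b s₁ s₂ n₁ n₂ hb ht _ _ ih₁ ih₂ =>
    intro emb exit hm v
    obtain ⟨v₁, h₁⟩ := ih₁ (fun l => emb (.inr ⟨_, l⟩)) (emb (.inl ()))
      (fun l => hm (.inr ⟨_, l⟩)) (v.1, (s k).head?)
    obtain ⟨v₂, h₂⟩ := ih₂ emb exit hm v₁
    refine ⟨v₂, Steps.trans (Steps.one
      (step_of_eq (hm (.inl ())) ((stepAux_popStmt e ..).trans ?_))) (h₁.trans h₂)⟩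
    rw [stepAux]
    simp [hb, ht]

/-- Halting is replaced by a jump to `exit` within the same step, so the number of steps does not
change. -/
theorem steps_lift {Λ : Type} (m : Λ → TM2.Stmt (M.ExtΓ J) Λ M.ExtState) (emb : M.Λ → Λ) (exit : Λ)
    (hm : ∀ l, m (emb l) = liftStmt emb exit (M.m l)) (n : ℕ) (c c' : M.Cfg)
    (h : Steps M.step n c c') :
    Steps (TM2.step m) n (liftCfg emb exit c) (liftCfg emb exit c') := by
  induction n generalizing c with
  | zero =>
    obtain rfl : c = c' := Option.some_injective _ h
    exact Steps.refl _ _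
  | succ n ih =>
    obtain ⟨b, hb, hn⟩ := h.head
    rw [Nat.add_comm]
    refine Steps.trans (Steps.one ?_) (ih b hn)
    obtain ⟨l, v, S⟩ := c
    cases l with
    | none => cases hb
    | some l =>
      obtain rfl : stepAux (M.m l) v S = b := Option.some_injective _ hb
      rw [liftCfg, TM2.step, Option.elim_some, hm, stepAux_liftStmt]

/-- The number of push operations of a statement bounds the growth of all stacks. -/
theorem exists_length_stepAux_le {K : Type} [DecidableEq K] {Γ : K → Type} {Λ σ : Type}
    (q : TM2.Stmt Γ Λ σ) :
    ∃ d, ∀ v S k, ((stepAux q v S).stk k).length ≤ (S k).length + d := by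
  induction q with
  | push k f q ih =>
    obtain ⟨d, hd⟩ := ih
    refine ⟨d + 1, fun v S k' => (hd _ _ k').trans ?_⟩
    by_cases h : k' = k
    · subst h; rw [Function.update_self, List.length_cons]; omega
    · rw [Function.update_of_ne h]; omega
  | peek k f q ih => obtain ⟨d, hd⟩ := ih; exact ⟨d, fun v S k' => hd _ _ k'⟩
  | pop k f q ih =>
    obtain ⟨d, hd⟩ := ih
    refine ⟨d, fun v S k' => (hd _ _ k').trans ?_⟩
    by_cases h : k' = k
    · subst h; simp
    · simp [h]
  | load f q ih => obtain ⟨d, hd⟩ := ih; exact ⟨d, fun v S k' => hd _ _ k'⟩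
  | branch f q₁ q₂ ih₁ ih₂ =>
    obtain ⟨d₁, hd₁⟩ := ih₁
    obtain ⟨d₂, hd₂⟩ := ih₂
    refine ⟨d₁ + d₂, fun v S k' => ?_⟩
    rw [stepAux]
    cases f v
    · exact (hd₂ v S k').trans (by omega)
    · exact (hd₁ v S k').trans (by omega)
  | goto f => exact ⟨0, fun v S k' => le_rfl⟩
  | halt => exact ⟨0, fun v S k' => le_rfl⟩

/-- Bounds the output length of a machine by its running time. This keeps a second phase, whose time
is measured in that output, polynomial in the original input. -/
theorem exists_length_le (M : FinTM2) :
    ∃ d, ∀ n (c c' : M.Cfg), Steps M.step n c c' →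
      ∀ k, (c'.stk k).length ≤ (c.stk k).length + n * d := by
  choose d hd using fun l => exists_length_stepAux_le (M.m l)
  have := M.ΛFin
  refine ⟨∑ l, d l, fun n => ?_⟩
  induction n with
  | zero =>
    intro c c' h k
    obtain rfl : c = c' := Option.some_injective _ h
    simp
  | succ n ih =>
    intro c c' h k
    obtain ⟨b, hb, hn⟩ := h.head
    have h₁ := ih b c' hn k
    obtain ⟨l, v, S⟩ := c
    cases l with
    | none => cases hb
    | some l =>
      obtain rfl : stepAux (M.m l) v S = b := Option.some_injective _ hb
      have h₂ := hd l v S k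
      have h₃ : d l ≤ ∑ l, d l := Finset.single_le_sum (fun _ _ => Nat.zero_le _) (Finset.mem_univ l)
      rw [Nat.add_mul, Nat.one_mul]
      change _ ≤ (S k).length + _
      change ((stepAux (M.m l) v S).stk k).length ≤ _ at h₂
      omega

/-- The machine that first runs `M` and then the program `c` on the output of `M`. -/
@[reducible] noncomputable def andThen (M : FinTM2) (e : M.Γ M.k₁ ≃ Bool) {J : Type}
    [DecidableEq J] [Fintype J] (c : Cmd (Option J)) (h₁ : Option J) : FinTM2 where
  K := M.K ⊕ J
  kDecidableEq := inferInstance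
  kFin := have := M.kFin; inferInstance
  k₀ := .inl M.k₀
  k₁ := handle M.k₁ h₁
  Γ := M.ExtΓ J
  Λ := M.Λ ⊕ (c.Lab ⊕ Unit)
  main := .inl M.main
  ΛFin := have := M.ΛFin; inferInstance
  σ := M.ExtState
  initialState := (M.initialState, none)
  σFin := have := M.σFin; inferInstance
  Γk₀Fin := M.Γk₀Fin
  m
    | .inl l => liftStmt .inl (.inr (.inl c.entry)) (M.m l)
    | .inr (.inl l) => code e c (fun l => .inr (.inl l)) (.inr (.inr ())) l
    -- A proper halting configuration has the initial internal state, so it is restored in one last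
    -- step.
    | .inr (.inr _) => .load (fun _ => (M.initialState, none)) .halt

end Turing.FinTM2

theorem Turing.initList_eq (M : FinTM2) (l : List (M.Γ M.k₀)) :
    initList M l = ⟨some M.main, M.initialState, Function.update (fun _ => []) M.k₀ l⟩ := by
  unfold initList
  congr 1
  funext k
  by_cases h : k = M.k₀
  · subst h; simp
  · simp [h]

theorem Turing.haltList_eq (M : FinTM2) (l : List (M.Γ M.k₁)) :
    haltList M l = ⟨none, M.initialState, Function.update (fun _ => []) M.k₁ l⟩ := by
  unfold haltList
  congr 1
  funext k
  by_cases h : k = M.k₁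
  · subst h; simp
  · simp [h]

theorem Turing.length_initList_le (M : FinTM2) (l : List (M.Γ M.k₀)) (k : M.K) :
    ((initList M l).stk k).length ≤ l.length := by
  rw [initList_eq]
  dsimp only
  by_cases h : k = M.k₀
  · subst h
    rw [Function.update_self]
  · rw [Function.update_of_ne h]
    exact Nat.zero_le _

theorem Turing.haltList_stk (M : FinTM2) (l : List (M.Γ M.k₁)) :
    (haltList M l).stk M.k₁ = l := by
  rw [haltList_eq]
  dsimp only
  rw [Function.update_self]

theorem Polynomial.eval_mono_nat (p : Polynomial ℕ) {a b : ℕ} (h : a ≤ b) :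
    p.eval a ≤ p.eval b := by
  rw [Polynomial.eval_eq_sum, Polynomial.eval_eq_sum]
  exact Finset.sum_le_sum fun i _ => Nat.mul_le_mul le_rfl (Nat.pow_le_pow_left h i)

open Turing StateTransition in
/-- A polynomial time computable function may be followed by a stack program that runs in
polynomial time. -/
theorem PolyTime.andThen {α β γ J : Type} [DecidableEq J] [Fintype J] {ea : α → List Bool}
    {eb : β → List Bool} {ec : γ → List Bool} {f : α → β} {g : β → γ} (hf : PolyTime ea eb f)
    (c : Cmd (Option J)) (h₁ : Option J) (p : Polynomial ℕ)
    (hc : ∀ b, ∃ n ≤ p.eval (eb b).length,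
      c.Runs (Function.update (fun _ => []) none (eb b))
        (Function.update (fun _ => []) h₁ (ec (g b))) n) :
    PolyTime ea ec (fun a => g (f a)) := by
  obtain ⟨T⟩ := hf
  choose n₂ hn₂ hr using hc
  obtain ⟨d, hd⟩ := FinTM2.exists_length_le T.tm
  refine ⟨⟨⟨FinTM2.andThen T.tm T.outputAlphabet c h₁, T.inputAlphabet, FinTM2.handleAlphabet T.outputAlphabet h₁⟩,
    -- The first machine, then the program on an output of length at most |input| + time · `d`, then
    -- the step that resets the state.
    T.time + (p.comp (Polynomial.X + T.time * Polynomial.C d) + 1), fun a => ?_⟩⟩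
  have run := T.outputsFun a
  have hs : Steps T.tm.step run.steps _ _ := run.evals_in_steps
  have hle := run.steps_le_m
  generalize hn : run.steps = n at hs hle
  have hlen := hd _ _ _ hs T.tm.k₁
  have hlen' : (eb (f a)).length ≤ (ea a).length + T.time.eval (ea a).length * d := by
    rw [haltList_stk, List.length_map] at hlen
    exact hlen.trans (Nat.add_le_add ((length_initList_le ..).trans (List.length_map _).le)
      (Nat.mul_le_mul hle le_rfl))
  have hn₂ := hn₂ (f a)
  have hr := hr (f a)
  generalize n₂ (f a) = n₂ at hn₂ hr
  have h₁' := FinTM2.steps_lift (J := J) (FinTM2.andThen T.tm T.outputAlphabet c h₁).m Sum.inl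
    (Sum.inr (Sum.inl c.entry)) (fun l => rfl) _ _ _ hs
  have h₃ : Steps (FinTM2.andThen T.tm T.outputAlphabet c h₁).step (n + (n₂ + 1))
      (initList (FinTM2.andThen T.tm T.outputAlphabet c h₁) ((ea a).map T.inputAlphabet.invFun))
      (haltList (FinTM2.andThen T.tm T.outputAlphabet c h₁)
        ((ec (g (f a))).map (FinTM2.handleAlphabet T.outputAlphabet h₁).invFun)) := by
    obtain ⟨v, h₂⟩ := FinTM2.steps_code T.outputAlphabet (FinTM2.andThen T.tm T.outputAlphabet c h₁).m hr
      (fun l => Sum.inr (Sum.inl l)) (Sum.inr (Sum.inr ())) (fun l => rfl) (T.tm.initialState, none)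
    rw [initList_eq, haltList_eq]
    rw [initList_eq, haltList_eq] at h₁'
    have e₁ : FinTM2.extStk (J := J) (Function.update (fun _ => []) T.tm.k₀
        ((ea a).map T.inputAlphabet.invFun)) = Function.update (β := fun k => List (T.tm.ExtΓ J k))
          (fun _ => []) (Sum.inl T.tm.k₀) ((ea a).map T.inputAlphabet.invFun) := by
      rw [FinTM2.extStk_update]
      congr 1
      funext k; cases k <;> rfl
    have e₂ : FinTM2.extStk (J := J) (Function.update (fun _ => []) T.tm.k₁
        ((eb (f a)).map T.outputAlphabet.invFun)) =
        FinTM2.handleStk T.outputAlphabet (Function.update (fun _ => []) none (eb (f a))) := by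
      funext k; cases k <;> simp [FinTM2.extStk, FinTM2.handleStk]
    have e₃ : FinTM2.handleStk T.outputAlphabet (Function.update (fun _ => []) h₁ (ec (g (f a)))) =
        Function.update (β := fun k => List (T.tm.ExtΓ J k)) (fun _ => [])
          (FinTM2.handle T.tm.k₁ h₁) ((ec (g (f a))).map (FinTM2.handleAlphabet T.outputAlphabet h₁).invFun) := by
      rw [FinTM2.handleStk_update]
      congr 1
      funext k; cases k <;> simp [FinTM2.handleStk]
    rw [FinTM2.liftCfg, FinTM2.liftCfg, e₁, e₂] at h₁'
    rw [e₃] at h₂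
    refine h₁'.trans (h₂.trans (Steps.one ?_))
    rfl
  exact ⟨⟨n + (n₂ + 1), h₃⟩, by
    simp only [Polynomial.eval_add, Polynomial.eval_comp, Polynomial.eval_X, Polynomial.eval_mul,
      Polynomial.eval_C, Polynomial.eval_one]
    have := p.eval_mono_nat hlen'
    omega⟩

/-! ### Specifications of stack programs -/

namespace Cmd

open Function (update)

variable {H : Type} [DecidableEq H]

/-- The program leads from the stacks `s` to the stacks `s'` in at most `n` steps. -/
def RunsIn (c : Cmd H) (s s' : H → List Bool) (n : ℕ) : Prop := ∃ m ≤ n, Runs c s s' m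

theorem RunsIn.mono {c : Cmd H} {s s' : H → List Bool} {m n : ℕ} (h : RunsIn c s s' m)
    (hmn : m ≤ n) : RunsIn c s s' n :=
  let ⟨k, hk, hr⟩ := h
  ⟨k, hk.trans hmn, hr⟩

theorem RunsIn.cast {c : Cmd H} {s s' s'' : H → List Bool} {n : ℕ} (h : RunsIn c s s' n)
    (e : s' = s'') : RunsIn c s s'' n := e ▸ h

theorem RunsIn.skip (s : H → List Bool) : RunsIn skip s s 1 := ⟨1, le_rfl, .skip s⟩

theorem RunsIn.push (k : H) (b : Bool) (s : H → List Bool) :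
    RunsIn (push k b) s (update s k (b :: s k)) 1 := ⟨1, le_rfl, .push k b s⟩

theorem RunsIn.seq {c₁ c₂ : Cmd H} {s s₁ s₂ : H → List Bool} {n₁ n₂ : ℕ}
    (h₁ : RunsIn c₁ s s₁ n₁) (h₂ : RunsIn c₂ s₁ s₂ n₂) : RunsIn (seq c₁ c₂) s s₂ (n₁ + n₂) :=
  let ⟨k₁, hk₁, hr₁⟩ := h₁
  let ⟨k₂, hk₂, hr₂⟩ := h₂
  ⟨k₁ + k₂, Nat.add_le_add hk₁ hk₂, .seq hr₁ hr₂⟩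

theorem RunsIn.branch {k : H} {body : Option Bool → Cmd H} {s s' : H → List Bool} {n : ℕ}
    (h : RunsIn (body (s k).head?) (update s k (s k).tail) s' n) :
    RunsIn (branch k body) s s' (1 + n) :=
  let ⟨k, hk, hr⟩ := h
  ⟨1 + k, Nat.add_le_add_left hk 1, .branch hr⟩

theorem RunsIn.loop_done {k : H} {test : Bool → Bool} {body : Bool → Cmd H} {s : H → List Bool}
    (h : ∀ b, (s k).head? = some b → test b = false) :
    RunsIn (loop k test body) s (update s k (s k).tail) 1 := ⟨1, le_rfl, .loop_done h⟩

theorem RunsIn.loop_step {k : H} {test : Bool → Bool} {body : Bool → Cmd H}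
    {s s₁ s₂ : H → List Bool} {b : Bool} {l : List Bool} {n₁ n₂ : ℕ} (hs : s k = b :: l)
    (ht : test b = true) (h₁ : RunsIn (body b) (update s k l) s₁ n₁)
    (h₂ : RunsIn (loop k test body) s₁ s₂ n₂) : RunsIn (loop k test body) s s₂ (1 + (n₁ + n₂)) :=
  let ⟨k₁, hk₁, hr₁⟩ := h₁
  let ⟨k₂, hk₂, hr₂⟩ := h₂
  ⟨1 + (k₁ + k₂), by omega, .loop_step (by rw [hs]; rfl) ht (by rw [hs]; exact hr₁) hr₂⟩

/-- The rule for a loop that pops `a` ones from a stack. -/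
theorem RunsIn.loop_unary {k : H} {body : Bool → Cmd H} {rest : List Bool} {t : ℕ}
    (hrest : ∀ b, rest.head? = some b → b = false) (a : ℕ) (f : ℕ → H → List Bool)
    (hf : ∀ i ≤ a, f i k = List.replicate (a - i) true ++ rest)
    (hbody : ∀ i < a, RunsIn (body true)
      (update (f i) k (List.replicate (a - (i + 1)) true ++ rest)) (f (i + 1)) t) :
    RunsIn (loop k id body) (f 0) (update (f a) k rest.tail) (a * (t + 1) + 1) := by
  induction a generalizing f with
  | zero =>
    have h0 : f 0 k = rest := by simpa using hf 0 le_rfl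
    have := RunsIn.loop_done (k := k) (test := id) (body := body) (s := f 0)
      (fun b hb => hrest b (by rwa [← h0]))
    rw [h0] at this
    simpa using this
  | succ a ih =>
    have h0 := hf 0 (Nat.zero_le _)
    rw [Nat.sub_zero, List.replicate_succ, List.cons_append] at h0
    have h1 := hbody 0 (Nat.succ_pos a)
    rw [Nat.zero_add, Nat.add_sub_cancel] at h1
    have h2 := ih (fun i => f (i + 1))
      (fun i hi => by rw [hf (i + 1) (by omega), Nat.add_sub_add_right])
      (fun i hi => by
        have := hbody (i + 1) (by omega)
        rwa [Nat.add_sub_add_right] at this)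
    exact (RunsIn.loop_step h0 rfl h1 h2).mono (by rw [Nat.add_mul a 1]; omega)

/-- Add the number on the stack `k` to the stack `j`, using the auxiliary stack `tmp`. -/
def addTo (tmp k j : H) : Cmd H :=
  seq (loop k id fun _ => seq (push tmp true) (push j true)) (loop tmp id fun _ => push k true)

/-- The first loop moves the ones of `k` to both `tmp` and `j` (3a + 1 steps), and the second
restores `k` from `tmp` (2a + 1 steps). -/
theorem runsIn_addTo {tmp k j : H} (hk : k ≠ tmp) (hj : j ≠ tmp) (hkj : k ≠ j)
    {s : H → List Bool} {a : ℕ} (ha : s k = List.replicate a true) (ht : s tmp = []) :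
    RunsIn (addTo tmp k j) s (update s j (List.replicate a true ++ s j)) (5 * a + 2) := by
  have h₁ := RunsIn.loop_unary (k := k) (body := fun _ => seq (push tmp true) (push j true))
    (rest := []) (t := 2) (by simp) a
    (fun i => update (update (update s k (List.replicate (a - i) true)) tmp
      (List.replicate i true)) j (List.replicate i true ++ s j))
    (fun i _ => by simp [hk, hkj]) ?_
  have h₂ := RunsIn.loop_unary (k := tmp) (body := fun _ => push k true)
    (rest := []) (t := 1) (by simp) a
    (fun i => update (update (update s k (List.replicate i true)) tmp
      (List.replicate (a - i) true)) j (List.replicate a true ++ s j))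
    (fun i _ => by simp [hj.symm]) ?_
  · have e₀ : update (update (update s k (List.replicate (a - 0) true)) tmp
        (List.replicate 0 true)) j (List.replicate 0 true ++ s j) = s := by
      rw [Nat.sub_zero, ← ha, Function.update_eq_self, List.replicate_zero, ← ht,
        Function.update_eq_self, ht, List.nil_append, Function.update_eq_self]
    have e₁ : update (update (update (update s k (List.replicate (a - a) true)) tmp
        (List.replicate a true)) j (List.replicate a true ++ s j)) k [].tail =
        update (update (update s k (List.replicate 0 true)) tmp
        (List.replicate (a - 0) true)) j (List.replicate a true ++ s j) := by
      rw [Function.update_comm hkj.symm, Function.update_comm hk.symm]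
      simp
    have e₂ : update (update (update (update s k (List.replicate a true)) tmp
        (List.replicate (a - a) true)) j (List.replicate a true ++ s j)) tmp [].tail =
        update s j (List.replicate a true ++ s j) := by
      rw [← ha, Function.update_eq_self, Function.update_comm hj, Nat.sub_self,
        List.replicate_zero, Function.update_idem, List.tail_nil, ← ht, Function.update_eq_self]
    rw [e₀, e₁] at h₁
    rw [e₂] at h₂
    exact (h₁.seq h₂).mono (by omega)
  · intro i _
    refine (RunsIn.push _ _ _).cast ?_
    funext x
    by_cases hx : x = j
    · simp [hx, hj, hkj.symm]
    · by_cases hx' : x = tmp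
      · simp [hx', hk.symm, hj.symm]
      · by_cases hx'' : x = k
        · simp [hx'', hkj, hk, List.replicate_succ]
        · simp [hx, hx', hx'']
  · intro i _
    refine ((RunsIn.push _ _ _).seq (RunsIn.push _ _ _)).cast ?_
    funext x
    by_cases hx : x = j
    · simp [hx, hj, hkj.symm, List.replicate_succ]
    · by_cases hx' : x = tmp
      · simp [hx', hk.symm, hj.symm, List.replicate_succ]
      · by_cases hx'' : x = k
        · simp [hx'', hkj, hk]
        · simp [hx, hx', hx'']

/-- Empty a stack that contains ones only. -/
def clear (k : H) : Cmd H := loop k id fun _ => skip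

theorem runsIn_clear {k : H} {s : H → List Bool} {a : ℕ} (ha : s k = List.replicate a true) :
    RunsIn (clear k) s (update s k []) (2 * a + 1) := by
  have h := RunsIn.loop_unary (k := k) (body := fun _ => skip)
    (rest := []) (t := 1) (by simp) a (fun i => update s k (List.replicate (a - i) true))
    (fun i _ => by simp) (fun i _ => by simpa using RunsIn.skip _)
  rw [Nat.sub_zero, ← ha, Function.update_eq_self, Function.update_idem] at h
  exact h.mono (by omega)

/-- Add the length of the stack `k` to the stack `j`, using the auxiliary stack `tmp`. -/
def addLength (tmp k j : H) : Cmd H :=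
  seq (loop k (fun _ => true) fun b => seq (push tmp b) (push j true))
    (loop tmp (fun _ => true) fun b => push k b)

theorem runsIn_unload {tmp k j : H} (hk : k ≠ tmp) (hj : j ≠ tmp) (hkj : k ≠ j)
    (l : List Bool) (s : H → List Bool) (hs : s k = l) :
    RunsIn (loop k (fun _ => true) fun b => seq (push tmp b) (push j true)) s
      (update (update (update s k []) tmp (l.reverse ++ s tmp)) j
        (List.replicate l.length true ++ s j)) (3 * l.length + 1) := by
  induction l generalizing s with
  | nil =>
    refine (RunsIn.loop_done (by simp [hs])).cast ?_
    rw [hs]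
    funext x
    by_cases hx : x = j
    · simp [hx, hkj.symm]
    · by_cases hx' : x = tmp
      · simp [hx', hk.symm, hj.symm]
      · simp [hx, hx']
  | cons b l ih =>
    refine ((RunsIn.loop_step hs rfl ((RunsIn.push _ _ _).seq (RunsIn.push _ _ _))
      (ih _ (by simp [hk, hkj]))).mono (by simp; omega)).cast ?_
    funext x
    by_cases hx : x = j
    · simp [hx, hj, hkj.symm, List.replicate_succ']
    · by_cases hx' : x = tmp
      · simp [hx', hk.symm, hj.symm]
      · by_cases hx'' : x = k
        · simp [hx'', hkj, hk]
        · simp [hx, hx', hx'']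

theorem runsIn_reload {tmp k : H} (hk : k ≠ tmp) (l : List Bool) (s : H → List Bool)
    (hs : s tmp = l) :
    RunsIn (loop tmp (fun _ => true) fun b => push k b) s
      (update (update s k (l.reverse ++ s k)) tmp []) (2 * l.length + 1) := by
  induction l generalizing s with
  | nil =>
    refine (RunsIn.loop_done (by simp [hs])).cast ?_
    simp [hs]
  | cons b l ih =>
    refine ((RunsIn.loop_step hs rfl (RunsIn.push _ _ _) (ih _ (by simp [hk.symm]))).mono
      (by simp; omega)).cast ?_
    funext x
    by_cases hx' : x = tmp
    · simp [hx']
    · by_cases hx'' : x = k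
      · simp [hx'', hk]
      · simp [hx', hx'']

/-- Passing through `tmp` reverses the stack twice, so its contents are restored. -/
theorem runsIn_addLength {tmp k j : H} (hk : k ≠ tmp) (hj : j ≠ tmp) (hkj : k ≠ j)
    {s : H → List Bool} (ht : s tmp = []) :
    RunsIn (addLength tmp k j) s (update s j (List.replicate (s k).length true ++ s j))
      (5 * (s k).length + 2) := by
  have h₁ := runsIn_unload hk hj hkj (s k) s rfl
  have h₂ := runsIn_reload hk (s k).reverse (update (update (update s k []) tmp
    ((s k).reverse ++ s tmp)) j (List.replicate (s k).length true ++ s j)) (by simp [hj.symm, ht])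
  refine ((h₁.seq h₂).mono (by simp; omega)).cast ?_
  funext x
  by_cases hx : x = j
  · simp [hx, hj, hkj.symm]
  · by_cases hx' : x = tmp
    · simp [hx', hj.symm, ht]
    · by_cases hx'' : x = k
      · simp [hx'', hkj, hk]
      · simp [hx, hx', hx'']

/-- Push the code of the sum of the numbers on the stacks `ks` as a list item on the stack `out`. -/
def pushSum (tmp out : H) (ks : List H) : Cmd H :=
  seq (push out false)
    (ks.foldr (fun k c => seq (addTo tmp k out) c) (push out true))

/-- A stack is written back to front: first the closing zero of the unary code, then the ones of all
summands, and last the one that announces a list item. -/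
theorem runsIn_pushSum {tmp out : H} (hot : out ≠ tmp) {ks : List H} {v : H → ℕ} {q : ℕ}
    {s : H → List Bool} (ht : s tmp = [])
    (hks : ∀ k ∈ ks, k ≠ tmp ∧ k ≠ out ∧ s k = List.replicate (v k) true ∧ v k ≤ q) :
    RunsIn (pushSum tmp out ks) s (update s out (true :: (encUnary (ks.map v).sum ++ s out)))
      (ks.length * (5 * q + 2) + 2) := by
  -- The induction over `ks` changes the contents of `out` at every summand, so they have to be
  -- general.
  suffices h : ∀ (l : List Bool) (s : H → List Bool), s tmp = [] → s out = l →
      (∀ k ∈ ks, k ≠ tmp ∧ k ≠ out ∧ s k = List.replicate (v k) true ∧ v k ≤ q) →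
      RunsIn (ks.foldr (fun k c => seq (addTo tmp k out) c) (push out true)) s
        (update s out (true :: (List.replicate (ks.map v).sum true ++ l)))
        (ks.length * (5 * q + 2) + 1) by
    refine (((RunsIn.push out false s).seq (h (false :: s out) _ (by simp [hot.symm, ht]) (by simp)
      fun k hk => ?_)).mono (by omega)).cast ?_
    · obtain ⟨h₁, h₂, h₃, h₄⟩ := hks k hk
      exact ⟨h₁, h₂, by simp [h₂, h₃], h₄⟩
    · simp [encUnary]
  clear hks ht
  induction ks with
  | nil =>
    intro l s ht hl _
    exact ((RunsIn.push out true s).mono (by simp)).cast (by simp [hl])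
  | cons k ks ih =>
    intro l s ht hl hks
    obtain ⟨h₁, h₂, h₃, h₄⟩ := hks k (by simp)
    refine (((runsIn_addTo h₁ hot h₂ h₃ ht).seq
      (ih (List.replicate (v k) true ++ l) _ ?_ ?_ ?_)).mono ?_).cast ?_
    · simp [hot.symm, ht]
    · simp [hl]
    · intro k' hk'
      obtain ⟨h₁, h₂, h₃, h₄⟩ := hks k' (by simp [hk'])
      exact ⟨h₁, h₂, by simp [h₂, h₃], h₄⟩
    · simp only [List.length_cons, Nat.add_mul]
      omega
    · rw [Function.update_idem, List.map_cons, List.sum_cons, ← List.append_assoc,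
        List.replicate_append_replicate, Nat.add_comm (v k)]

/-- Push the code of a list of sums of numbers on stacks as a list item on the stack `out`. -/
def pushSums (tmp out : H) (kss : List (List H)) : Cmd H :=
  seq (push out false)
    (seq (kss.foldr (fun ks c => seq c (pushSum tmp out ks)) skip) (push out true))

/-- Again back to front: the fold executes the tail of `kss` before its head. -/
theorem runsIn_pushSums {tmp out : H} (hot : out ≠ tmp) {kss : List (List H)} {v : H → ℕ} {q : ℕ}
    {s : H → List Bool} (ht : s tmp = [])
    (hks : ∀ ks ∈ kss, ∀ k ∈ ks, k ≠ tmp ∧ k ≠ out ∧ s k = List.replicate (v k) true ∧ v k ≤ q) :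
    RunsIn (pushSums tmp out kss) s
      (update s out (true :: (encList encUnary (kss.map fun ks => (ks.map v).sum) ++ s out)))
      ((kss.map List.length).sum * (5 * q + 2) + 2 * kss.length + 3) := by
  suffices h : ∀ (s : H → List Bool), s tmp = [] →
      (∀ ks ∈ kss, ∀ k ∈ ks, k ≠ tmp ∧ k ≠ out ∧ s k = List.replicate (v k) true ∧ v k ≤ q) →
      RunsIn (kss.foldr (fun ks c => seq c (pushSum tmp out ks)) skip) s
        (update s out ((kss.map fun ks => (ks.map v).sum).flatMap (fun a => true :: encUnary a) ++
          s out))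
        ((kss.map List.length).sum * (5 * q + 2) + 2 * kss.length + 1) by
    refine (((RunsIn.push out false s).seq ((h _ (by simp [hot.symm, ht]) ?_).seq
      (RunsIn.push out true _))).mono (by omega)).cast ?_
    · intro ks hks' k hk
      obtain ⟨h₁, h₂, h₃, h₄⟩ := hks ks hks' k hk
      exact ⟨h₁, h₂, by simp [h₂, h₃], h₄⟩
    · simp [encList]
  clear hks ht
  induction kss with
  | nil =>
    intro s ht _
    exact ((RunsIn.skip s).mono (by simp)).cast (by simp)
  | cons ks kss ih =>
    intro s ht hks
    refine (((ih s ht fun ks' hks' => hks ks' (by simp [hks'])).seq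
      (runsIn_pushSum (v := v) (q := q) hot ?_ ?_)).mono ?_).cast ?_
    · simp [hot.symm, ht]
    · intro k hk
      obtain ⟨h₁, h₂, h₃, h₄⟩ := hks ks (by simp) k hk
      exact ⟨h₁, h₂, by simp [h₂, h₃], h₄⟩
    · simp only [List.length_cons, List.map_cons, List.sum_cons, Nat.add_mul]
      omega
    · rw [Function.update_idem, List.map_cons, List.flatMap_cons]
      simp

end Cmd

/-! ### The terms produced by the reduction -/

/-- The instruction `(p, i, j)` adds the product of the columns `i` and `j` to the column `p`. -/
abbrev Instr : Type := ℕ × ℕ × ℕ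

/-- The instructions that compute a gate into the column `p`. The wire `i` is held in the column
`i + 2`, and the column `0` holds the constant one. -/
def Gate.instrs (p : ℕ) : Gate → List Instr
  | and i j => [(p, i + 2, j + 2)]
  | or i j => [(p, i + 2, i + 2), (p, j + 2, j + 2), (p, i + 2, j + 2)]
  | not i => [(p, 0, 0), (p, i + 2, i + 2)]

/-- The instructions that compute a list of gates into the columns `p, p + 1, …`. -/
def gatesInstrs : ℕ → List Gate → List Instr
  | _, [] => []
  | p, g :: gs => g.instrs p ++ gatesInstrs (p + 1) gs

/-- The cubic term of an instruction at the row that starts at `b`, where rows have length `w`. -/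
def instrTerm (w b : ℕ) (o : Instr) : List ℕ :=
  [b + o.2.1, b + (w + o.1), b + (w + (w + o.2.2))]

/-- The cubic terms of a list of instructions, each of which occupies four rows. -/
def instrTerms (w : ℕ) : ℕ → List Instr → List (List ℕ)
  | _, [] => []
  | b, o :: os => instrTerm w b o :: instrTerms w (b + 4 * w) os

/-- The quadratic term that links two consecutive rows. -/
def linkTerm (w c d : ℕ) : List ℕ := [d + c, d + (c + w)]

theorem instrTerms_append (w b : ℕ) (l₁ l₂ : List Instr) :
    instrTerms w b (l₁ ++ l₂) =
      instrTerms w b l₁ ++ instrTerms w (b + 4 * w * l₁.length) l₂ := by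
  induction l₁ generalizing b with
  | nil => rfl
  | cons o l₁ ih =>
    have h : b + 4 * w + 4 * w * l₁.length = b + 4 * w * (o :: l₁).length := by
      rw [List.length_cons]; ring
    rw [List.cons_append, instrTerms, ih, instrTerms, List.cons_append, h]

namespace Circuit

/-- The column that receives a copy of the output. -/
def outCol (C : Circuit) : ℕ := C.numInputs + 2 + C.gates.length

/-- All instructions for the circuit. -/
def instrs (C : Circuit) : List Instr :=
  gatesInstrs (C.numInputs + 2) C.gates ++
    ((C.outCol, C.output + 2, C.output + 2) ::
      ((List.range (C.numInputs + 1)).map (fun d => (d + 1, d + 1, 0)) ++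
        [(0, C.outCol, C.outCol)]))

/-- The number of columns. -/
def width (C : Circuit) : ℕ := C.encode.length

/-- The number of terms that link rows. -/
def numLinks (C : Circuit) : ℕ := C.width + 4 * C.width * C.instrs.length

/-- The terms of the polynomial, as sorted lists of variables. -/
def termLists (C : Circuit) : List (List ℕ) :=
  (List.range C.numLinks).map (linkTerm C.width (C.numInputs + 2)) ++
    (instrTerms C.width C.width C.instrs).reverse

/-- The number of variables of the polynomial. -/
def polyVars (C : Circuit) : ℕ := C.numInputs + 2 + (C.width + C.numLinks) + 1

end Circuit

/-! ### The program of the reduction -/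

namespace Reduction

open Cmd Function

/-- The stacks of the reduction, in addition to its input stack: the output `O`, the number `A` of
columns that are initially free, the width `W`, the start `B` of the current row, the current
column `P`, the arguments `X` and `Y`, the number `N` of variables, an auxiliary stack `T` and an
empty stack `Z`. -/
inductive Stk : Type
  | O | A | W | B | P | X | Y | N | T | Z
  deriving DecidableEq

open Stk

instance : Fintype Stk := ⟨{O, A, W, B, P, X, Y, N, T, Z}, fun k => by cases k <;> decide⟩

/-- The contents of the stacks, given the bits on the input stack and the output stack and the
numbers on the other stacks. -/
def st (inp out : List Bool) (v : Stk → ℕ) : Option Stk → List Bool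
  | none => inp
  | some O => out
  | some k => List.replicate (v k) true

/-- The numbers on the stacks. -/
def cnt (a w b p x y n : ℕ) : Stk → ℕ
  | A => a
  | W => w
  | B => b
  | P => p
  | X => x
  | Y => y
  | N => n
  | _ => 0

theorem st_some {inp out : List Bool} {v : Stk → ℕ} {k : Stk} (hk : k ≠ O) :
    st inp out v (some k) = List.replicate (v k) true := by
  cases k <;> first | rfl | exact absurd rfl hk

@[simp] theorem st_none {inp out : List Bool} {v : Stk → ℕ} : st inp out v none = inp := rfl

@[simp] theorem st_O {inp out : List Bool} {v : Stk → ℕ} : st inp out v (some O) = out := rfl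

@[simp] theorem update_st_none {inp out l : List Bool} {v : Stk → ℕ} :
    update (st inp out v) none l = st l out v := by
  funext k
  rcases k with _ | k
  · rfl
  · cases k <;> rfl

@[simp] theorem update_st_O {inp out l : List Bool} {v : Stk → ℕ} :
    update (st inp out v) (some O) l = st inp l v := by
  funext k
  rcases k with _ | k
  · rfl
  · cases k <;> rfl

theorem update_st_some {inp out : List Bool} {v : Stk → ℕ} {k : Stk} (hk : k ≠ O) (n : ℕ) :
    update (st inp out v) (some k) (List.replicate n true) = st inp out (update v k n) := by
  funext k'
  rcases k' with _ | k'
  · rfl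
  · by_cases h : k' = k
    · subst h
      rw [update_self, st_some hk, update_self]
    · rw [update_of_ne (by simpa using h)]
      cases k' <;> first | rfl | simp [st, h]

section cnt

variable (a w b p x y n m : ℕ)

@[simp] theorem update_cnt_A : update (cnt a w b p x y n) A m = cnt m w b p x y n := by
  funext k; cases k <;> rfl

@[simp] theorem update_cnt_W : update (cnt a w b p x y n) W m = cnt a m b p x y n := by
  funext k; cases k <;> rfl

@[simp] theorem update_cnt_B : update (cnt a w b p x y n) B m = cnt a w m p x y n := by
  funext k; cases k <;> rfl

@[simp] theorem update_cnt_P : update (cnt a w b p x y n) P m = cnt a w b m x y n := by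
  funext k; cases k <;> rfl

@[simp] theorem update_cnt_X : update (cnt a w b p x y n) X m = cnt a w b p m y n := by
  funext k; cases k <;> rfl

@[simp] theorem update_cnt_Y : update (cnt a w b p x y n) Y m = cnt a w b p x m n := by
  funext k; cases k <;> rfl

@[simp] theorem update_cnt_N : update (cnt a w b p x y n) N m = cnt a w b p x y m := by
  funext k; cases k <;> rfl

@[simp] theorem cnt_A : cnt a w b p x y n A = a := rfl
@[simp] theorem cnt_W : cnt a w b p x y n W = w := rfl
@[simp] theorem cnt_B : cnt a w b p x y n B = b := rfl
@[simp] theorem cnt_P : cnt a w b p x y n P = p := rfl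
@[simp] theorem cnt_X : cnt a w b p x y n X = x := rfl
@[simp] theorem cnt_Y : cnt a w b p x y n Y = y := rfl
@[simp] theorem cnt_N : cnt a w b p x y n N = n := rfl
@[simp] theorem cnt_T : cnt a w b p x y n T = 0 := rfl
@[simp] theorem cnt_Z : cnt a w b p x y n Z = 0 := rfl

end cnt

variable {inp out rest : List Bool} {v : Stk → ℕ}

/-- Add the number on one stack to another. -/
def add (k j : Stk) : Cmd (Option Stk) := addTo (some T) (some k) (some j)

theorem runsIn_add {k j : Stk} (hk : k ≠ T ∧ k ≠ O) (hj : j ≠ T ∧ j ≠ O) (hkj : k ≠ j)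
    (hT : v T = 0) :
    RunsIn (add k j) (st inp out v) (st inp out (update v j (v k + v j))) (5 * v k + 2) := by
  refine (runsIn_addTo (by simpa using hk.1) (by simpa using hj.1) (by simpa using hkj)
    (st_some hk.2) (by rw [st_some (by decide), hT]; rfl)).cast ?_
  rw [st_some hj.2, List.replicate_append_replicate, update_st_some hj.2]

/-- Increase the number on a stack. -/
def inc (k : Stk) : Cmd (Option Stk) := push (some k) true

theorem runsIn_inc {k : Stk} (hk : k ≠ O) :
    RunsIn (inc k) (st inp out v) (st inp out (update v k (v k + 1))) 1 := by
  refine (RunsIn.push _ _ _).cast ?_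
  rw [st_some hk, ← List.replicate_succ, update_st_some hk]

/-- Set the number on a stack to zero. -/
def reset (k : Stk) : Cmd (Option Stk) := clear (some k)

theorem runsIn_reset {k : Stk} (hk : k ≠ O) :
    RunsIn (reset k) (st inp out v) (st inp out (update v k 0)) (2 * v k + 1) := by
  refine (runsIn_clear (st_some hk)).cast ?_
  rw [← update_st_some hk]
  rfl

/-- Write a term whose variables are sums of the numbers on some stacks. -/
def writeTerm (kss : List (List Stk)) : Cmd (Option Stk) :=
  pushSums (some T) (some O) (kss.map (List.map some))

theorem runsIn_writeTerm {kss : List (List Stk)} {q : ℕ} (ts : List (List ℕ)) (hT : v T = 0)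
    (h : ∀ ks ∈ kss, ∀ k ∈ ks, k ≠ T ∧ k ≠ O ∧ v k ≤ q) :
    RunsIn (writeTerm kss) (st inp (encList (encList encUnary) ts) v)
      (st inp (encList (encList encUnary) ((kss.map fun ks => (ks.map v).sum) :: ts)) v)
      ((kss.map List.length).sum * (5 * q + 2) + 2 * kss.length + 3) := by
  have := runsIn_pushSums (tmp := some T) (out := some O) (by simp)
    (kss := kss.map (List.map some)) (v := fun k => k.elim 0 v) (q := q)
    (s := st inp (encList (encList encUnary) ts) v) (by rw [st_some (by decide), hT]; rfl) (by
      simp only [List.forall_mem_map]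
      intro ks hks k hk
      obtain ⟨h₁, h₂, h₃⟩ := h ks hks k hk
      exact ⟨by simpa using h₁, by simpa using h₂, st_some h₂, h₃⟩)
  rw [update_st_O] at this
  simp only [List.map_map, Function.comp_def, List.length_map, Option.elim_some] at this
  exact this.cast (by simp [encList])

/-- Write the term of an instruction and advance by four rows. -/
def writeInstr (tgt a b : Stk) : Cmd (Option Stk) :=
  seq (writeTerm [[B, a], [B, W, tgt], [B, W, W, b]])
    (seq (add W B) (seq (add W B) (seq (add W B) (add W B))))

/-- The three variables are sums of 2 + 3 + 4 = 9 stacks, which costs 9(5q + 2) + 9 steps. The four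
additions of `W` cost 4(5q + 2). -/
theorem runsIn_writeInstr {tgt a b : Stk} {q : ℕ} (ts : List (List ℕ)) (hT : v T = 0)
    (h : ∀ k ∈ [tgt, a, b], k ≠ T ∧ k ≠ O) (hv : ∀ k, v k ≤ q) :
    RunsIn (writeInstr tgt a b) (st inp (encList (encList encUnary) ts) v)
      (st inp (encList (encList encUnary) (instrTerm (v W) (v B) (v tgt, v a, v b) :: ts))
        (update v B (v B + 4 * v W))) (65 * q + 35) := by
  simp only [List.forall_mem_cons, List.not_mem_nil, false_implies, implies_true, and_true] at h
  obtain ⟨h₁, h₂, h₃⟩ := h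
  have hW := hv W
  refine (((runsIn_writeTerm (q := q) ts hT ?_).seq
    ((runsIn_add (by decide) (by decide) (by decide) hT).seq
    ((runsIn_add (by decide) (by decide) (by decide) ?_).seq
    ((runsIn_add (by decide) (by decide) (by decide) ?_).seq
    (runsIn_add (by decide) (by decide) (by decide) ?_))))).mono ?_).cast ?_
  · simp [hv, h₁, h₂, h₃]
  · simp [hT]
  · simp [hT]
  · simp [hT]
  · simp; omega
  · simp only [update_idem, update_self, update_of_ne (show W ≠ B by decide), instrTerm,
      List.map_cons, List.map_nil, List.sum_cons, List.sum_nil, Nat.add_zero]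
    congr 2
    omega

/-- Read the number of a wire and compute its column. -/
def readWire (k : Stk) : Cmd (Option Stk) :=
  seq (inc k) (seq (inc k) (loop none id fun _ => inc k))

/-- The two extra increments skip the columns of the constant and of the dummy. The loop also
consumes the zero that closes the unary code. -/
theorem runsIn_readWire {k : Stk} (hk : k ≠ O) (hv : v k = 0) (i : ℕ) :
    RunsIn (readWire k) (st (encUnary i ++ rest) out v) (st rest out (update v k (i + 2)))
      (2 * i + 3) := by
  have h := RunsIn.loop_unary (k := (none : Option Stk)) (body := fun _ => inc k)
    (rest := false :: rest) (t := 1) (by simp) i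
    (fun m => st (List.replicate (i - m) true ++ false :: rest) out (update v k (m + 2)))
    (fun m _ => rfl) (fun m _ => by
      rw [update_st_none]
      exact (runsIn_inc hk).cast (by simp))
  rw [update_st_none, Nat.sub_zero] at h
  have h₀ : RunsIn (inc k) (st (encUnary i ++ rest) out v)
      (st (encUnary i ++ rest) out (update v k 1)) 1 := (runsIn_inc hk).cast (by rw [hv])
  have h₁ : RunsIn (inc k) (st (encUnary i ++ rest) out (update v k 1))
      (st (encUnary i ++ rest) out (update v k 2)) 1 := (runsIn_inc hk).cast (by simp)
  have e : encUnary i ++ rest = List.replicate i true ++ false :: rest := by simp [encUnary]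
  rw [e] at h₀ h₁ ⊢
  exact (h₀.seq (h₁.seq h)).mono (by omega)

/-- Process a conjunction. -/
def andGate : Cmd (Option Stk) :=
  seq (readWire X) (seq (readWire Y) (seq (writeInstr P X Y) (seq (reset X) (reset Y))))

/-- Process a disjunction. -/
def orGate : Cmd (Option Stk) :=
  seq (readWire X) (seq (readWire Y) (seq (writeInstr P X X) (seq (writeInstr P Y Y)
    (seq (writeInstr P X Y) (seq (reset X) (reset Y))))))

/-- Process a negation. -/
def notGate : Cmd (Option Stk) :=
  seq (writeInstr P Z Z) (seq (readWire X) (seq (writeInstr P X X) (reset X)))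

/-- Process a gate. -/
def gate : Cmd (Option Stk) :=
  seq (branch none fun
      | some true => branch none fun
        | some true => andGate
        | _ => orGate
      | _ => notGate)
    (inc P)

theorem runsIn_branch_none {b : Bool} {body : Option Bool → Cmd (Option Stk)}
    {s : Option Stk → List Bool} {n : ℕ} (h : RunsIn (body (some b)) (st rest out v) s n) :
    RunsIn (branch none body) (st (b :: rest) out v) s (1 + n) :=
  RunsIn.branch (by rw [update_st_none]; exact h)

theorem cnt_le {a w b p x y n q : ℕ} (h : a ≤ q ∧ w ≤ q ∧ b ≤ q ∧ p ≤ q ∧ x ≤ q ∧ y ≤ q ∧ n ≤ q)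
    (k : Stk) : cnt a w b p x y n k ≤ q := by
  cases k <;> simp [cnt] <;> omega

/-- The time is dominated by the disjunction, which writes three instructions. The terms appear
reversed because each one is pushed in front of the earlier ones. -/
theorem runsIn_gate (g : Gate) (ts : List (List ℕ)) {a w b p q m : ℕ} (hg : g.ReadsBelow m)
    (hm : m + 2 ≤ q) (ha : a ≤ q) (hw : w ≤ q) (hb : b + 4 * w * (g.instrs p).length ≤ q)
    (hp : p ≤ q) :
    RunsIn gate (st (g.encode ++ rest) (encList (encList encUnary) ts) (cnt a w b p 0 0 0))
      (st rest (encList (encList encUnary) ((instrTerms w b (g.instrs p)).reverse ++ ts))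
        (cnt a w (b + 4 * w * (g.instrs p).length) (p + 1) 0 0 0)) (210 * q + 120) := by
  have key : ∀ (tgt a' b' : Stk), (∀ k ∈ [tgt, a', b'], k ≠ T ∧ k ≠ O) →
      ∀ b x y ts rest, b ≤ q → x ≤ q → y ≤ q →
      RunsIn (writeInstr tgt a' b') (st rest (encList (encList encUnary) ts) (cnt a w b p x y 0))
        (st rest (encList (encList encUnary) (instrTerm w b (cnt a w b p x y 0 tgt,
          cnt a w b p x y 0 a', cnt a w b p x y 0 b') :: ts)) (cnt a w (b + 4 * w) p x y 0))
        (65 * q + 35) := by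
    intro tgt a' b' h b x y ts rest hb hx hy
    exact (runsIn_writeInstr ts rfl h (cnt_le (by omega))).cast (by simp)
  have hX : ∀ i out b y rest, RunsIn (readWire X) (st (encUnary i ++ rest) out (cnt a w b p 0 y 0))
      (st rest out (cnt a w b p (i + 2) y 0)) (2 * i + 3) := fun i out b y rest =>
    (runsIn_readWire (by decide) rfl i).cast (by simp)
  have hY : ∀ i out b x rest, RunsIn (readWire Y) (st (encUnary i ++ rest) out (cnt a w b p x 0 0))
      (st rest out (cnt a w b p x (i + 2) 0)) (2 * i + 3) := fun i out b y rest =>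
    (runsIn_readWire (by decide) rfl i).cast (by simp)
  have hX' : ∀ out b x y rest, RunsIn (reset X) (st rest out (cnt a w b p x y 0))
      (st rest out (cnt a w b p 0 y 0)) (2 * x + 1) := fun out b x y rest =>
    (runsIn_reset (by decide)).cast (by simp)
  have hY' : ∀ out b x y rest, RunsIn (reset Y) (st rest out (cnt a w b p x y 0))
      (st rest out (cnt a w b p x 0 0)) (2 * y + 1) := fun out b x y rest =>
    (runsIn_reset (by decide)).cast (by simp)
  have hP : ∀ out b rest, RunsIn (inc P) (st rest out (cnt a w b p 0 0 0))
      (st rest out (cnt a w b (p + 1) 0 0 0)) 1 := fun out b rest =>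
    (runsIn_inc (by decide)).cast (by simp)
  cases g with
  | and i j =>
    obtain ⟨hi, hj⟩ := hg
    simp only [Gate.instrs, List.length_cons, List.length_nil] at hb
    simp only [Gate.encode, List.cons_append, List.append_assoc]
    have h : RunsIn andGate _ _ _ := (hX _ _ _ _ _).seq ((hY j _ _ _ rest).seq
      ((key P X Y (by decide) b (i + 2) (j + 2) ts _ (by omega)
        (by omega) (by omega)).seq ((hX' _ _ _ _ _).seq (hY' _ _ _ _ _))))
    refine (((runsIn_branch_none (runsIn_branch_none h)).seq (hP _ _ _)).mono ?_).cast ?_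
    · omega
    · simp [Gate.instrs, instrTerms]
  | or i j =>
    obtain ⟨hi, hj⟩ := hg
    simp only [Gate.instrs, List.length_cons, List.length_nil] at hb
    simp only [Gate.encode, List.cons_append, List.append_assoc]
    have h : RunsIn orGate _ _ _ := (hX _ _ _ _ _).seq ((hY j _ _ _ rest).seq
      ((key P X X (by decide) b (i + 2) (j + 2) ts _ (by omega) (by omega) (by omega)).seq
      ((key P Y Y (by decide) _ _ _ _ _ (by omega) (by omega) (by omega)).seq
      ((key P X Y (by decide) _ _ _ _ _ (by omega) (by omega) (by omega)).seq
      ((hX' _ _ _ _ _).seq (hY' _ _ _ _ _))))))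
    refine (((runsIn_branch_none (runsIn_branch_none h)).seq (hP _ _ _)).mono ?_).cast ?_
    · omega
    · simp [Gate.instrs, instrTerms]
      congr 2
      omega
  | not i =>
    simp only [Gate.ReadsBelow] at hg
    simp only [Gate.instrs, List.length_cons, List.length_nil] at hb
    simp only [Gate.encode, List.cons_append]
    have h : RunsIn notGate _ _ _ := (key P Z Z (by decide) b 0 0 ts (encUnary i ++ rest) (by omega)
      (by omega) (by omega)).seq ((hX _ _ _ _ _).seq ((key P X X (by decide) _ _ _ _ _ (by omega)
        (by omega) (by omega)).seq (hX' _ _ _ _ _)))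
    refine (((runsIn_branch_none h).seq (hP _ _ _)).mono ?_).cast ?_
    · omega
    · simp [Gate.instrs, instrTerms]
      congr 2
      omega

/-- Process a list of gates. -/
def gates : Cmd (Option Stk) := loop none id fun _ => gate

theorem runsIn_gates (gs : List Gate) (ts : List (List ℕ)) {a w b p q m : ℕ}
    (hg : ∀ g ∈ gs, g.ReadsBelow m)
    (hm : m + 2 ≤ q) (ha : a ≤ q) (hw : w ≤ q) (hb : b + 4 * w * (gatesInstrs p gs).length ≤ q)
    (hp : p + gs.length ≤ q) :
    RunsIn gates (st (encList Gate.encode gs ++ rest) (encList (encList encUnary) ts)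
        (cnt a w b p 0 0 0))
      (st rest (encList (encList encUnary) ((instrTerms w b (gatesInstrs p gs)).reverse ++ ts))
        (cnt a w (b + 4 * w * (gatesInstrs p gs).length) (p + gs.length) 0 0 0))
      (gs.length * (210 * q + 121) + 1) := by
  induction gs generalizing ts b p with
  | nil =>
    refine ((RunsIn.loop_done ?_).mono (by simp)).cast ?_
    · simp [encList]
    · simp [encList, gatesInstrs, instrTerms]
  | cons g gs ih =>
    simp only [gatesInstrs, List.length_append, List.length_cons, Nat.mul_add,
      instrTerms_append] at hb hp ⊢
    have h₁ := runsIn_gate (rest := encList Gate.encode gs ++ rest) g ts (p := p) (b := b)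
      (hg g (by simp)) hm ha hw (by omega) (by omega)
    have h₂ := ih ((instrTerms w b (g.instrs p)).reverse ++ ts) (p := p + 1)
      (b := b + 4 * w * (g.instrs p).length) (fun g' hg' => hg g' (by simp [hg']))
      (by omega) (by omega)
    rw [show encList Gate.encode (g :: gs) ++ rest =
      true :: (g.encode ++ (encList Gate.encode gs ++ rest)) by simp [encList]]
    -- The gate starts after the loop has popped the item marker; this brings its initial stacks
    -- into that form.
    rw [← update_st_none (inp := true :: (g.encode ++ (encList Gate.encode gs ++ rest)))] at h₁
    refine ((RunsIn.loop_step (test := id) (body := fun _ => gate) rfl rfl h₁ h₂).mono ?_).cast ?_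
    · simp only [Nat.add_mul, Nat.mul_add]
      omega
    · rw [List.reverse_append, List.append_assoc, Nat.add_assoc b, Nat.add_assoc p,
        Nat.add_comm 1]

/-- Copy the output wire to a new column. -/
def copyOutput : Cmd (Option Stk) :=
  seq (readWire Y) (seq (writeInstr P Y Y) (reset Y))

theorem runsIn_copyOutput (o : ℕ) (ts : List (List ℕ)) {a w b p q : ℕ}
    (ho : o + 2 ≤ q) (ha : a ≤ q) (hw : w ≤ q) (hb : b ≤ q) (hp : p ≤ q) :
    RunsIn copyOutput (st (encUnary o) (encList (encList encUnary) ts) (cnt a w b p 0 0 0))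
      (st [] (encList (encList encUnary) (instrTerm w b (p, o + 2, o + 2) :: ts))
        (cnt a w (b + 4 * w) p 0 0 0)) (70 * q + 40) := by
  have h₁ : RunsIn (readWire Y) (st (encUnary o) (encList (encList encUnary) ts)
      (cnt a w b p 0 0 0)) (st [] (encList (encList encUnary) ts) (cnt a w b p 0 (o + 2) 0))
      (2 * o + 3) := by
    have := (runsIn_readWire (k := Y) (rest := []) (out := encList (encList encUnary) ts)
      (v := cnt a w b p 0 0 0) (by decide) rfl o)
    rw [List.append_nil, update_cnt_Y] at this
    exact this
  refine ((h₁.seq ((runsIn_writeInstr (q := q) ts rfl (by decide) (cnt_le (by omega))).seq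
    (runsIn_reset (by decide)))).mono ?_).cast ?_
  · simp
    omega
  · simp

/-- The instructions that force the initially free columns to vanish. -/
def erase : Cmd (Option Stk) :=
  seq (add A Y) (seq (branch (some Y) fun _ => skip)
    (seq (loop (some Y) id fun _ => seq (inc X) (writeInstr X X Z))
      (seq (reset X) (seq (writeInstr Z P P) (reset P)))))

/-- Of the `n + 2` free columns, column 0 controls the erasure and is not erased by the loop, so the
`branch` pops one from the counter. The empty stack `Z` stands for column 0. -/
theorem runsIn_erase (n : ℕ) (ts : List (List ℕ)) {w b p q : ℕ}
    (hn : n + 2 ≤ q) (hw : w ≤ q) (hb : b + 4 * w * (n + 2) ≤ q) (hp : p ≤ q) :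
    RunsIn erase (st [] (encList (encList encUnary) ts) (cnt (n + 2) w b p 0 0 0))
      (st [] (encList (encList encUnary) ((instrTerms w b
        ((List.range (n + 1)).map (fun d => (d + 1, d + 1, 0)) ++ [(0, p, p)])).reverse ++ ts))
        (cnt (n + 2) w (b + 4 * w * (n + 2)) 0 0 0 0))
      ((n + 1) * (65 * q + 37) + 75 * q + 50) := by
  have hb' : ∀ i ≤ n + 1, b + 4 * w * i ≤ q := fun i hi =>
    (Nat.add_le_add_left (Nat.mul_le_mul_left _ (by omega)) b).trans hb
  have h₁ : RunsIn (add A Y) (st [] (encList (encList encUnary) ts) (cnt (n + 2) w b p 0 0 0))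
      (st [] (encList (encList encUnary) ts) (cnt (n + 2) w b p 0 (n + 2) 0))
      (5 * (n + 2) + 2) :=
    (runsIn_add (by decide) (by decide) (by decide) rfl).cast (by simp)
  have h₂ : RunsIn (branch (some Y) fun _ => skip)
      (st [] (encList (encList encUnary) ts) (cnt (n + 2) w b p 0 (n + 2) 0))
      (st [] (encList (encList encUnary) ts) (cnt (n + 2) w b p 0 (n + 1) 0)) (1 + 1) := by
    refine RunsIn.branch ((RunsIn.skip _).cast ?_)
    rw [st_some (by decide), cnt_Y, List.tail_replicate, update_st_some (by decide), update_cnt_Y]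
    rfl
  have h₃ := RunsIn.loop_unary (k := some Y) (body := fun _ => seq (inc X) (writeInstr X X Z))
    (rest := []) (t := 65 * q + 36) (by simp) (n + 1)
    (fun i => st [] (encList (encList encUnary) ((instrTerms w b
      ((List.range i).map (fun d => (d + 1, d + 1, 0)))).reverse ++ ts))
      (cnt (n + 2) w (b + 4 * w * i) p i (n + 1 - i) 0))
    (fun i _ => by rw [st_some (by decide), cnt_Y, List.append_nil])
    (fun i hi => by
      rw [List.append_nil, update_st_some (by decide), update_cnt_Y]
      have h₁ : RunsIn (inc X) (st [] (encList (encList encUnary) ((instrTerms w b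
          ((List.range i).map (fun d => (d + 1, d + 1, 0)))).reverse ++ ts))
          (cnt (n + 2) w (b + 4 * w * i) p i (n + 1 - (i + 1)) 0))
          (st [] (encList (encList encUnary) ((instrTerms w b
          ((List.range i).map (fun d => (d + 1, d + 1, 0)))).reverse ++ ts))
          (cnt (n + 2) w (b + 4 * w * i) p (i + 1) (n + 1 - (i + 1)) 0)) 1 :=
        (runsIn_inc (by decide)).cast (by simp)
      have := hb' i hi.le
      refine ((h₁.seq (runsIn_writeInstr (q := q) _ rfl (by decide)
        (cnt_le (by omega)))).mono (by omega)).cast ?_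
      rw [List.range_succ, List.map_append, instrTerms_append]
      simp [instrTerms]
      ring_nf)
  rw [List.tail_nil, Nat.sub_self, ← List.replicate_zero (a := true), update_st_some (by decide),
    update_cnt_Y, show 65 * q + 36 + 1 = 65 * q + 37 from rfl] at h₃
  have h₄ : ∀ out b, RunsIn (reset X) (st [] out (cnt (n + 2) w b p (n + 1) 0 0))
      (st [] out (cnt (n + 2) w b p 0 0 0)) (2 * (n + 1) + 1) := fun out b =>
    (runsIn_reset (by decide)).cast (by simp)
  have := hb' (n + 1) le_rfl
  refine ((h₁.seq (h₂.seq (RunsIn.seq (by simpa [instrTerms] using h₃) ((h₄ _ _).seq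
    ((runsIn_writeInstr (q := q) _ rfl (by decide) (cnt_le (by omega))).seq
      (runsIn_reset (by decide))))))).mono ?_).cast ?_
  · simp
    omega
  · simp [instrTerms_append, instrTerms]
    ring_nf

/-- Write the terms that link rows. -/
def links : Cmd (Option Stk) := loop (some B) id fun _ => writeTerm [[B, A], [B, A, W]]

/-- `B` serves as counter and as index: after the pop it holds the index of the link to be written.
Counting down while pushing in front yields the increasing order. In the program, the row start
reached after the last instruction is exactly the number of links. -/
theorem runsIn_links (ts : List (List ℕ)) {a w b m q : ℕ} (ha : a ≤ q) (hw : w ≤ q) (hb : b ≤ q) :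
    RunsIn links (st [] (encList (encList encUnary) ts) (cnt a w b 0 0 0 m))
      (st [] (encList (encList encUnary) ((List.range b).map (linkTerm w a) ++ ts))
        (cnt a w 0 0 0 0 m)) (b * (25 * q + 18) + 1) := by
  have h := RunsIn.loop_unary (k := some B) (body := fun _ => writeTerm [[B, A], [B, A, W]])
    (rest := []) (t := 25 * q + 17) (by simp) b
    (fun i => st [] (encList (encList encUnary) ((List.range' (b - i) i).map (linkTerm w a) ++ ts))
      (cnt a w (b - i) 0 0 0 m))
    (fun i _ => by rw [st_some (by decide), cnt_B, List.append_nil])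
    (fun i hi => by
      rw [List.append_nil, update_st_some (by decide), update_cnt_B]
      refine ((runsIn_writeTerm (q := q) _ rfl ?_).mono ?_).cast ?_
      · simp
        omega
      · simp
        omega
      · have : b - i = b - (i + 1) + 1 := by omega
        simp [linkTerm, List.range'_succ, this])
  rw [List.tail_nil, Nat.sub_self, ← List.replicate_zero (a := true), update_st_some (by decide),
    update_cnt_B, ← List.range_eq_range',
    show 25 * q + 17 + 1 = 25 * q + 18 from rfl] at h
  simpa [links] using h

/-- Write the remaining terms and the number of variables, and clean up. -/
def finish : Cmd (Option Stk) :=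
  seq (add B N) (seq (add W N) (seq (add A N) (seq (inc N) (seq links (seq (reset A)
    (seq (reset W) (seq (push (some O) false)
      (loop (some N) id fun _ => push (some O) true))))))))

/-- The number of variables is written last because it comes first in the code. All working stacks
end empty, as a halting configuration requires. -/
theorem runsIn_finish (ts : List (List ℕ)) {a w b q : ℕ} (hq : a + (w + b) + 1 ≤ q) :
    RunsIn finish (st [] (encList (encList encUnary) ts) (cnt a w b 0 0 0 0))
      (st [] (encUnary (a + (w + b) + 1) ++
          encList (encList encUnary) ((List.range b).map (linkTerm w a) ++ ts))
        (cnt 0 0 0 0 0 0 0)) (q * (25 * q + 18) + 30 * q + 20) := by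
  have h₁ : ∀ out, RunsIn (add B N) (st [] out (cnt a w b 0 0 0 0))
      (st [] out (cnt a w b 0 0 0 b)) (5 * b + 2) := fun out =>
    (runsIn_add (by decide) (by decide) (by decide) rfl).cast (by simp)
  have h₂ : ∀ out, RunsIn (add W N) (st [] out (cnt a w b 0 0 0 b))
      (st [] out (cnt a w b 0 0 0 (w + b))) (5 * w + 2) := fun out =>
    (runsIn_add (by decide) (by decide) (by decide) rfl).cast (by simp)
  have h₃ : ∀ out, RunsIn (add A N) (st [] out (cnt a w b 0 0 0 (w + b)))
      (st [] out (cnt a w b 0 0 0 (a + (w + b)))) (5 * a + 2) := fun out =>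
    (runsIn_add (by decide) (by decide) (by decide) rfl).cast (by simp)
  have h₄ : ∀ out, RunsIn (inc N) (st [] out (cnt a w b 0 0 0 (a + (w + b))))
      (st [] out (cnt a w b 0 0 0 (a + (w + b) + 1))) 1 := fun out =>
    (runsIn_inc (by decide)).cast (by simp)
  have h₅ := runsIn_links ts (a := a) (w := w) (b := b) (m := a + (w + b) + 1) (q := q)
    (by omega) (by omega) (by omega)
  have h₆ : ∀ out m, RunsIn (reset A) (st [] out (cnt a w 0 0 0 0 m))
      (st [] out (cnt 0 w 0 0 0 0 m)) (2 * a + 1) := fun out m =>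
    (runsIn_reset (by decide)).cast (by simp)
  have h₇ : ∀ out m, RunsIn (reset W) (st [] out (cnt 0 w 0 0 0 0 m))
      (st [] out (cnt 0 0 0 0 0 0 m)) (2 * w + 1) := fun out m =>
    (runsIn_reset (by decide)).cast (by simp)
  have h₈ : ∀ out m, RunsIn (push (some O) false) (st [] out (cnt 0 0 0 0 0 0 m))
      (st [] (false :: out) (cnt 0 0 0 0 0 0 m)) 1 := fun out m =>
    (RunsIn.push _ _ _).cast (by simp)
  have h₉ : ∀ out m, RunsIn (loop (some N) id fun _ => push (some O) true)
      (st [] (false :: out) (cnt 0 0 0 0 0 0 m))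
      (st [] (encUnary m ++ out) (cnt 0 0 0 0 0 0 0)) (m * (1 + 1) + 1) := by
    intro out m
    have h := RunsIn.loop_unary (k := some N) (body := fun _ => push (some O) true)
      (rest := []) (t := 1) (by simp) m
      (fun i => st [] (List.replicate i true ++ false :: out) (cnt 0 0 0 0 0 0 (m - i)))
      (fun i _ => by rw [st_some (by decide), cnt_N, List.append_nil])
      (fun i hi => by
        rw [List.append_nil, update_st_some (by decide), update_cnt_N]
        exact (RunsIn.push _ _ _).cast (by simp [List.replicate_succ]))
    rw [List.tail_nil, Nat.sub_self, ← List.replicate_zero (a := true),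
      update_st_some (by decide), update_cnt_N] at h
    simpa [encUnary] using h
  have hb : b * (25 * q + 18) ≤ q * (25 * q + 18) := Nat.mul_le_mul_right _ (by omega)
  exact ((h₁ _).seq ((h₂ _).seq ((h₃ _).seq ((h₄ _).seq (h₅.seq ((h₆ _ _).seq ((h₇ _ _).seq
    ((h₈ _ _).seq (h₉ _ _))))))))).mono (by omega)

/-- Compute the width and the number of inputs, and start the list of terms. -/
def start : Cmd (Option Stk) :=
  seq (addLength (some T) none (some W)) (seq (loop none id fun _ => seq (inc A) (inc P))
    (seq (inc A) (seq (inc A) (seq (inc P) (seq (inc P) (seq (add W B)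
      (push (some O) false)))))))

/-- Any polynomial bound on the number of columns can serve as width. The length of the whole input
is one that can be measured before anything is parsed. -/
theorem runsIn_start (n : ℕ) :
    RunsIn start (st (encUnary n ++ rest) [] (cnt 0 0 0 0 0 0 0))
      (st rest (encList (encList encUnary) []) (cnt (n + 2) (encUnary n ++ rest).length
        (encUnary n ++ rest).length (n + 2) 0 0 0)) (13 * (encUnary n ++ rest).length + 10) := by
  generalize hw : (encUnary n ++ rest).length = w
  have hn : n ≤ w := by
    rw [← hw, List.length_append, encUnary, List.length_append, List.length_replicate]
    omega
  have h₁ : RunsIn (addLength (some T) none (some W)) (st (encUnary n ++ rest) [] (cnt 0 0 0 0 0 0 0))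
      (st (encUnary n ++ rest) [] (cnt 0 w 0 0 0 0 0)) (5 * w + 2) := by
    have := runsIn_addLength (tmp := some T) (k := none) (j := some W) (by simp) (by simp) (by simp)
      (s := st (encUnary n ++ rest) [] (cnt 0 0 0 0 0 0 0)) rfl
    rw [st_none, hw, st_some (by decide), cnt_W, List.replicate_zero, List.append_nil,
      update_st_some (by decide), update_cnt_W] at this
    exact this
  have h₂ : RunsIn (loop none id fun _ => seq (inc A) (inc P))
      (st (encUnary n ++ rest) [] (cnt 0 w 0 0 0 0 0)) (st rest [] (cnt n w 0 n 0 0 0))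
      (n * (2 + 1) + 1) := by
    have h := RunsIn.loop_unary (k := (none : Option Stk)) (body := fun _ => seq (inc A) (inc P))
      (rest := false :: rest) (t := 2) (by simp) n
      (fun i => st (List.replicate (n - i) true ++ false :: rest) [] (cnt i w 0 i 0 0 0))
      (fun i _ => rfl) (fun i _ => by
        rw [update_st_none]
        exact ((runsIn_inc (by decide)).seq (runsIn_inc (by decide))).cast (by simp))
    rw [update_st_none, Nat.sub_zero] at h
    simpa [encUnary] using h
  have h₃ : ∀ a p, RunsIn (inc A) (st rest [] (cnt a w 0 p 0 0 0))
      (st rest [] (cnt (a + 1) w 0 p 0 0 0)) 1 := fun a p =>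
    (runsIn_inc (by decide)).cast (by simp)
  have h₄ : ∀ a p, RunsIn (inc P) (st rest [] (cnt a w 0 p 0 0 0))
      (st rest [] (cnt a w 0 (p + 1) 0 0 0)) 1 := fun a p =>
    (runsIn_inc (by decide)).cast (by simp)
  have h₅ : ∀ a p, RunsIn (add W B) (st rest [] (cnt a w 0 p 0 0 0))
      (st rest [] (cnt a w w p 0 0 0)) (5 * w + 2) := fun a p =>
    (runsIn_add (by decide) (by decide) (by decide) rfl).cast (by simp)
  have h₆ : ∀ v, RunsIn (push (some O) false) (st rest [] v)
      (st rest (encList (encList encUnary) []) v) 1 := fun v =>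
    (RunsIn.push _ _ _).cast (by simp [encList])
  exact (h₁.seq (h₂.seq ((h₃ _ _).seq ((h₃ _ _).seq ((h₄ _ _).seq ((h₄ _ _).seq ((h₅ _ _).seq
    (h₆ _)))))))).mono (by omega)

/-- The program of the reduction. -/
def program : Cmd (Option Stk) :=
  seq start (seq gates (seq copyOutput (seq erase finish)))

end Reduction

/-! ### Size bounds and the running time of the reduction -/

theorem Gate.length_encode_ge (g : Gate) : 2 ≤ g.encode.length := by
  cases g <;> simp [Gate.encode, encUnary]

theorem Gate.length_instrs_le (p : ℕ) (g : Gate) : (g.instrs p).length ≤ 3 := by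
  cases g <;> simp [Gate.instrs]

theorem length_gatesInstrs_le (p : ℕ) (gs : List Gate) :
    (gatesInstrs p gs).length ≤ 3 * gs.length := by
  induction gs generalizing p with
  | nil => rfl
  | cons g gs ih =>
    have := ih (p + 1)
    have := g.length_instrs_le p
    simp only [gatesInstrs, List.length_append, List.length_cons]
    omega

theorem length_encList_ge {α : Type} (e : α → List Bool) (m : ℕ) (l : List α)
    (h : ∀ a, m ≤ (e a).length) : (m + 1) * l.length + 1 ≤ (encList e l).length := by
  induction l with
  | nil => simp [encList]
  | cons a l ih =>
    have := h a
    simp only [encList, List.flatMap_cons, List.length_append, List.length_cons, List.length_nil,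
      Nat.mul_add] at ih ⊢
    omega

namespace Circuit

/-- Each gate contributes a marker and at least two bits to the code. Hence a row has room for the
constant, the dummy, all wires and the copy of the output, and the width also bounds the number of
instructions. -/
theorem width_ge (C : Circuit) :
    C.numInputs + 3 * C.gates.length + C.output + 3 ≤ C.width := by
  have := length_encList_ge Gate.encode 2 C.gates Gate.length_encode_ge
  simp only [width, encode, encUnary, List.length_append, List.length_replicate, List.length_cons,
    List.length_nil]
  omega

theorem length_instrs_le (C : Circuit) :
    C.instrs.length ≤ 3 * C.gates.length + C.numInputs + 3 := by
  have := length_gatesInstrs_le (C.numInputs + 2) C.gates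
  simp [instrs]
  omega

theorem polyVars_le (C : Circuit) : C.polyVars ≤ 4 * C.width ^ 2 + 3 * C.width + 1 := by
  have h₁ := C.width_ge
  have h₂ := C.length_instrs_le
  have h₃ : 4 * C.width * C.instrs.length ≤ 4 * C.width * C.width :=
    Nat.mul_le_mul_left _ (by omega)
  rw [polyVars, numLinks]
  nlinarith

end Circuit

-- The number of variables bounds every counter at every moment, so each loop takes at most that
-- many rounds of linear cost.
open Cmd Reduction Reduction.Stk in
theorem Reduction.runsIn_program (C : Circuit) :
    RunsIn program (st C.encode [] (cnt 0 0 0 0 0 0 0))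
      (st [] (encUnary C.polyVars ++ encList (encList encUnary) C.termLists)
        (cnt 0 0 0 0 0 0 0)) (400 * (C.polyVars + 1) ^ 2) := by
  have hw := C.width_ge
  have hout := C.output_wf
  have hq : C.polyVars = C.numInputs + 2 + (C.width + C.numLinks) + 1 := rfl
  have hlen : C.numLinks = C.width + 4 * C.width * (gatesInstrs (C.numInputs + 2) C.gates).length +
      4 * C.width + 4 * C.width * (C.numInputs + 2) := by
    rw [Circuit.numLinks, Circuit.instrs]
    simp only [List.length_append, List.length_cons, List.length_map, List.length_range,
      List.length_nil]
    ring
  generalize hq' : C.polyVars = q at hq ⊢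
  have h₁ := runsIn_start (rest := encList Gate.encode C.gates ++ encUnary C.output) C.numInputs
  change RunsIn start (st C.encode [] _) (st _ _ (cnt _ C.width C.width _ _ _ _))
    (13 * C.width + 10) at h₁
  have h₂ := runsIn_gates (rest := encUnary C.output) C.gates [] (a := C.numInputs + 2)
    (w := C.width) (b := C.width) (p := C.numInputs + 2) (q := q)
    (m := C.numInputs + C.gates.length)
    (by
      intro g hg
      obtain ⟨k, hk, rfl⟩ := List.getElem_of_mem hg
      have := C.gates_wf k hk
      revert this
      cases C.gates[k] <;> simp only [Gate.ReadsBelow] <;> omega)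
    (by omega) (by omega) (by omega) (by omega) (by omega)
  rw [List.append_nil] at h₂
  have h₃ := runsIn_copyOutput C.output
    (instrTerms C.width C.width (gatesInstrs (C.numInputs + 2) C.gates)).reverse
    (a := C.numInputs + 2) (w := C.width) (q := q)
    (b := C.width + 4 * C.width * (gatesInstrs (C.numInputs + 2) C.gates).length)
    (p := C.outCol) (by omega) (by omega) (by omega) (by omega) (by rw [Circuit.outCol]; omega)
  have h₄ := runsIn_erase C.numInputs (instrTerm C.width (C.width + 4 * C.width *
    (gatesInstrs (C.numInputs + 2) C.gates).length) (C.outCol, C.output + 2, C.output + 2) ::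
    (instrTerms C.width C.width (gatesInstrs (C.numInputs + 2) C.gates)).reverse)
    (w := C.width) (q := q) (p := C.outCol)
    (b := C.width + 4 * C.width * (gatesInstrs (C.numInputs + 2) C.gates).length + 4 * C.width)
    (by omega) (by omega) (by omega) (by rw [Circuit.outCol]; omega)
  rw [← hlen] at h₄
  have h₅ := fun ts => runsIn_finish ts (a := C.numInputs + 2) (w := C.width) (b := C.numLinks)
    (q := q) (by omega)
  have e₁ : C.gates.length * (210 * q + 121) ≤ q * (210 * q + 121) :=
    Nat.mul_le_mul_right _ (by omega)
  have e₂ : (C.numInputs + 1) * (65 * q + 37) ≤ q * (65 * q + 37) :=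
    Nat.mul_le_mul_right _ (by omega)
  refine ((h₁.seq (h₂.seq (h₃.seq (h₄.seq (h₅ _))))).mono ?_).cast ?_
  · have : C.width ≤ q := by omega
    nlinarith
  · rw [hq, Circuit.termLists, Circuit.instrs]
    simp [instrTerms_append, instrTerms]

/-! ### Multilinear polynomials over the field with two elements -/

namespace PolyF2

open MvPolynomial

/-- The exponent of a multilinear term. -/
noncomputable def expo {n : ℕ} (t : Finset (Fin n)) : Fin n →₀ ℕ := ∑ i ∈ t, Finsupp.single i 1

theorem expo_apply {n : ℕ} (t : Finset (Fin n)) (i : Fin n) : expo t i = if i ∈ t then 1 else 0 := by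
  rw [expo, Finsupp.finsetSum_apply]
  simp [Finsupp.single_apply]

theorem expo_injective {n : ℕ} : Function.Injective (expo (n := n)) := by
  intro s t h
  ext i
  have := DFunLike.congr_fun h i
  rw [expo_apply, expo_apply] at this
  by_cases hs : i ∈ s <;> by_cases ht : i ∈ t <;> simp_all

theorem degree_expo {n : ℕ} (t : Finset (Fin n)) : ((expo t).sum fun _ e => e) = t.card := by
  rw [Finsupp.sum_fintype _ _ (fun _ => rfl)]
  simp [expo_apply]

theorem toPoly_eq (P : PolyF2) :
    P.toPoly = ∑ t ∈ P.terms.toFinset, monomial (expo t) (1 : ZMod 2) := by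
  rw [toPoly, ← List.sum_toFinset _ P.terms_nodup]
  refine Finset.sum_congr rfl fun t _ => ?_
  rw [expo, monomial_sum_one]
  rfl

/-- Distinct sets of variables have distinct exponents, so no terms cancel modulo 2. This gives the
lower bound on the degree. -/
theorem coeff_expo (P : PolyF2) (t : Finset (Fin P.numVars)) (ht : t ∈ P.terms) :
    P.toPoly.coeff (expo t) = 1 := by
  rw [toPoly_eq, coeff_sum, Finset.sum_eq_single t]
  · simp
  · intro s _ hs
    rw [coeff_monomial, if_neg fun h => hs (expo_injective h)]
  · intro h
    exact absurd (List.mem_toFinset.2 ht) h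

theorem support_subset (P : PolyF2) : P.toPoly.support ⊆ P.terms.toFinset.image expo := by
  rw [toPoly_eq]
  refine (support_sum).trans (Finset.biUnion_subset.2 fun t ht => ?_)
  refine (support_monomial_subset).trans (Finset.singleton_subset_iff.2 ?_)
  exact Finset.mem_image_of_mem _ ht

theorem totalDegree_eq (P : PolyF2) (d : ℕ) (h : ∀ t ∈ P.terms, t.card ≤ d)
    (hd : ∃ t ∈ P.terms, t.card = d) : P.toPoly.totalDegree = d := by
  apply le_antisymm
  · refine Finset.sup_le fun m hm => ?_
    obtain ⟨t, ht, rfl⟩ := Finset.mem_image.1 (P.support_subset hm)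
    rw [degree_expo]
    exact h t (List.mem_toFinset.1 ht)
  · obtain ⟨t, ht, rfl⟩ := hd
    rw [← degree_expo]
    exact le_totalDegree (mem_support_iff.2 (by rw [coeff_expo P t ht]; exact one_ne_zero))

theorem numTermsWith_le (P : PolyF2) (i : Fin P.numVars) :
    numTermsWith P.toPoly i ≤ (P.terms.filter fun t => i ∈ t).length := by
  have h : P.toPoly.support.filter (fun m => m i ≠ 0) ⊆
      ((P.terms.filter fun t => i ∈ t).map expo).toFinset := by
    intro m hm
    obtain ⟨hm, hi⟩ := Finset.mem_filter.1 hm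
    obtain ⟨t, ht, rfl⟩ := Finset.mem_image.1 (P.support_subset hm)
    rw [expo_apply] at hi
    simp only [List.mem_toFinset, List.mem_map, List.mem_filter, decide_eq_true_eq] at ht ⊢
    exact ⟨t, ⟨ht, by_contra fun h => hi (if_neg h)⟩, rfl⟩
  refine (Finset.card_le_card h).trans ((List.toFinset_card_le _).trans ?_)
  rw [List.length_map]

/-- The finite set of variables that are listed in `t`. -/
def finTerm (m : ℕ) [NeZero m] (t : List ℕ) : Finset (Fin m) := (t.map (Fin.ofNat m)).toFinset

theorem mem_finTerm {m : ℕ} [NeZero m] {t : List ℕ} (ht : ∀ i ∈ t, i < m) (i : Fin m) :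
    i ∈ finTerm m t ↔ (i : ℕ) ∈ t := by
  rw [finTerm, List.mem_toFinset, List.mem_map]
  constructor
  · rintro ⟨a, ha, rfl⟩
    rwa [Fin.val_ofNat, Nat.mod_eq_of_lt (ht a ha)]
  · intro h
    exact ⟨i, h, by simp⟩

theorem pairwise_map_ofNat {m : ℕ} [NeZero m] {t : List ℕ} (hs : t.Pairwise (· < ·))
    (ht : ∀ i ∈ t, i < m) : (t.map (Fin.ofNat m)).Pairwise (· < ·) := by
  rw [List.pairwise_map]
  refine hs.imp_of_mem fun {a b} ha hb hab => ?_
  rw [Fin.lt_def, Fin.val_ofNat, Fin.val_ofNat, Nat.mod_eq_of_lt (ht a ha),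
    Nat.mod_eq_of_lt (ht b hb)]
  exact hab

/-- `PolyF2.encode` sorts each term, so an increasing list is reproduced literally. This identifies
the program's output with the code of the polynomial. -/
theorem sort_finTerm {m : ℕ} [NeZero m] {t : List ℕ} (hs : t.Pairwise (· < ·))
    (ht : ∀ i ∈ t, i < m) : (finTerm m t).sort (· ≤ ·) = t.map (Fin.ofNat m) := by
  have h := pairwise_map_ofNat hs ht
  rw [finTerm]
  exact (List.toFinset_sort (· ≤ ·) (h.imp fun h => h.ne)).2 (h.imp fun h => h.le)

theorem map_val_ofNat {m : ℕ} [NeZero m] {t : List ℕ} (ht : ∀ i ∈ t, i < m) :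
    (t.map (Fin.ofNat m)).map Fin.val = t := by
  rw [List.map_map]
  conv_rhs => rw [← List.map_id t]
  refine List.map_congr_left fun i hi => ?_
  simp [Nat.mod_eq_of_lt (ht i hi)]

theorem card_finTerm {m : ℕ} [NeZero m] {t : List ℕ} (hs : t.Pairwise (· < ·))
    (ht : ∀ i ∈ t, i < m) : (finTerm m t).card = t.length := by
  rw [finTerm, List.toFinset_card_of_nodup ((pairwise_map_ofNat hs ht).imp fun h => h.ne),
    List.length_map]

/-- The polynomial with a given list of terms, which are listed as increasing lists of numbers of
variables. -/
abbrev ofLists (m : ℕ) [NeZero m] (ts : List (List ℕ)) (hs : ∀ t ∈ ts, t.Pairwise (· < ·))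
    (ht : ∀ t ∈ ts, ∀ i ∈ t, i < m) (hn : ts.Nodup) : PolyF2 where
  numVars := m
  terms := ts.map (finTerm m)
  terms_nodup := by
    refine List.Nodup.map_on (fun s hs' t ht' h => ?_) hn
    rw [← map_val_ofNat (ht s hs'), ← map_val_ofNat (ht t ht'), ← sort_finTerm (hs s hs') (ht s hs'),
      ← sort_finTerm (hs t ht') (ht t ht'), h]

section ofLists

variable {m : ℕ} [NeZero m] {ts : List (List ℕ)} (hs : ∀ t ∈ ts, t.Pairwise (· < ·))
    (ht : ∀ t ∈ ts, ∀ i ∈ t, i < m) (hn : ts.Nodup)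

theorem encode_ofLists :
    (ofLists m ts hs ht hn).encode = encUnary m ++ encList (encList encUnary) ts := by
  rw [encode]
  congr 1
  simp only [encList, List.flatMap_map]
  congr 1
  refine List.flatMap_congr fun t ht' => ?_
  rw [sort_finTerm (hs t ht') (ht t ht')]
  conv_rhs => rw [← map_val_ofNat (ht t ht')]
  simp only [List.flatMap_map]

theorem numTermsWith_ofLists_le (i : Fin m) :
    numTermsWith (ofLists m ts hs ht hn).toPoly i ≤ (ts.filter fun t => (i : ℕ) ∈ t).length := by
  refine (numTermsWith_le (ofLists m ts hs ht hn) i).trans ?_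
  change ((ts.map (finTerm m)).filter fun t => i ∈ t).length ≤ _
  rw [List.filter_map, List.length_map]
  refine (congrArg List.length (List.filter_congr fun t ht' => ?_)).le
  simp [mem_finTerm (ht t ht')]

theorem totalDegree_ofLists (d : ℕ) (h : ∀ t ∈ ts, t.length ≤ d) (hd : ∃ t ∈ ts, t.length = d) :
    (ofLists m ts hs ht hn).toPoly.totalDegree = d := by
  apply totalDegree_eq
  · intro t' hmem
    obtain ⟨t, ht', rfl⟩ := List.mem_map.1 hmem
    rw [card_finTerm (hs t ht') (ht t ht')]
    exact h t ht'
  · obtain ⟨t, ht', rfl⟩ := hd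
    exact ⟨finTerm m t, List.mem_map_of_mem ht', card_finTerm (hs t ht') (ht t ht')⟩

theorem eval_ofLists (x : Fin m → ZMod 2) :
    eval x (ofLists m ts hs ht hn).toPoly =
      (ts.map fun t => (t.map fun i => x (Fin.ofNat m i)).prod).sum := by
  rw [toPoly, map_list_sum, List.map_map, List.map_map]
  refine congrArg List.sum (List.map_congr_left fun t ht' => ?_)
  simp only [Function.comp_apply, map_prod, eval_X]
  rw [finTerm, List.prod_toFinset _ ((pairwise_map_ofNat (hs t ht') (ht t ht')).imp fun h => h.ne),
    List.map_map]
  rfl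

end ofLists

end PolyF2

/-! ### The polynomial of a circuit -/

theorem instrTerms_eq (w b : ℕ) (l : List Instr) :
    instrTerms w b l = (List.range l.length).map
      fun k => instrTerm w (b + 4 * w * k) (l.getD k (0, 0, 0)) := by
  induction l generalizing b with
  | nil => rfl
  | cons o l ih =>
    rw [List.length_cons, List.range_succ_eq_map, List.map_cons, List.map_map, instrTerms, ih]
    congr 1
    refine List.map_congr_left fun k _ => ?_
    simp only [Function.comp_apply, List.getD_cons_succ, Nat.mul_succ]
    congr 1
    omega

/-- A gate reads only earlier wires, so both factors lie in columns to the left of the target. -/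
theorem gatesInstrs_bounds (n : ℕ) (gs : List Gate)
    (h : ∀ (k : ℕ) (hk : k < gs.length), (gs[k]).ReadsBelow (n + k)) :
    ∀ o ∈ gatesInstrs (n + 2) gs,
      o.1 < n + 2 + gs.length ∧ n + 2 ≤ o.1 ∧ o.2.1 < o.1 ∧ o.2.2 < o.1 := by
  induction gs generalizing n with
  | nil => simp [gatesInstrs]
  | cons g gs ih =>
    intro o ho
    rw [gatesInstrs, List.mem_append] at ho
    rcases ho with ho | ho
    · have hg := h 0 (by simp)
      rw [List.length_cons]
      cases g <;> simp [Gate.instrs, Gate.ReadsBelow] at ho hg <;>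
        rcases ho with rfl | rfl | rfl <;> dsimp only <;> omega
    · rw [show n + 2 + 1 = n + 1 + 2 by omega] at ho
      have := ih (n + 1) (fun k hk => by
        have := h (k + 1) (by simpa using hk)
        rwa [List.getElem_cons_succ, ← Nat.add_assoc, Nat.add_right_comm] at this) o ho
      rw [List.length_cons]
      omega

namespace Circuit

variable (C : Circuit)

/-- The last conjunct matters because the second factor is read from the row after the instruction,
where it must still have its old value. The first factor is read from the row before and may be the
target, as in the erasing instructions. -/
theorem instrs_bounds {o : Instr} (ho : o ∈ C.instrs) :
    o.1 < C.width ∧ o.2.1 < C.width ∧ o.2.2 < C.width ∧ o.2.2 ≠ o.1 := by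
  have hw := C.width_ge
  have hout := C.output_wf
  have hlen := C.gates.length
  simp only [instrs, List.mem_append, List.mem_cons, List.mem_map, List.mem_range, List.not_mem_nil,
    or_false, outCol] at ho
  rcases ho with ho | rfl | ⟨d, hd, rfl⟩ | rfl
  · have := gatesInstrs_bounds _ _ C.gates_wf o ho
    omega
  all_goals dsimp only; omega

/-- The instruction with a given index. -/
def instrAt (k : ℕ) : Instr := C.instrs.getD k (0, 0, 0)

theorem instrAt_bounds {k : ℕ} (hk : k < C.instrs.length) :
    (C.instrAt k).1 < C.width ∧ (C.instrAt k).2.1 < C.width ∧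
      (C.instrAt k).2.2 < C.width ∧
      (C.instrAt k).2.2 ≠ (C.instrAt k).1 := by
  rw [instrAt, List.getD_eq_getElem _ _ hk]
  exact C.instrs_bounds (List.getElem_mem hk)

theorem instrTerms_instrs : instrTerms C.width C.width C.instrs =
    (List.range C.instrs.length).map
      fun k => instrTerm C.width (C.width + 4 * C.width * k) (C.instrAt k) :=
  instrTerms_eq ..

theorem mem_termLists {t : List ℕ} : t ∈ C.termLists ↔
    (∃ d < C.numLinks, linkTerm C.width (C.numInputs + 2) d = t) ∨
    (∃ k < C.instrs.length, instrTerm C.width (C.width + 4 * C.width * k)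
      (C.instrAt k) = t) := by
  simp only [termLists, instrTerms_instrs, List.mem_append, List.mem_map, List.mem_range,
    List.mem_reverse]

theorem instrs_length_pos : 0 < C.instrs.length := by
  simp [instrs]

theorem instr_row_lt {k : ℕ} (hk : k < C.instrs.length) :
    C.width + 4 * C.width * k + 4 * C.width ≤ C.numLinks := by
  have := Nat.mul_le_mul_left (4 * C.width) (Nat.succ_le_of_lt hk)
  rw [Nat.mul_succ] at this
  rw [numLinks]
  omega

theorem termLists_sorted {t : List ℕ} (ht : t ∈ C.termLists) : t.Pairwise (· < ·) := by
  have hw := C.width_ge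
  rcases (C.mem_termLists).1 ht with ⟨d, hd, rfl⟩ | ⟨k, hk, rfl⟩
  · simp [linkTerm]
    omega
  · have := C.instrAt_bounds hk
    simp [instrTerm]
    omega

theorem termLists_lt {t : List ℕ} (ht : t ∈ C.termLists) {i : ℕ} (hi : i ∈ t) :
    i < C.polyVars := by
  have hw := C.width_ge
  rw [polyVars]
  rcases (C.mem_termLists).1 ht with ⟨d, hd, rfl⟩ | ⟨k, hk, rfl⟩
  · simp [linkTerm] at hi
    omega
  · have := C.instrAt_bounds hk
    have := C.instr_row_lt hk
    simp [instrTerm] at hi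
    omega

/-- The index of an instruction is determined by any variable of its term. -/
theorem instrTerm_index {k i : ℕ} (hk : k < C.instrs.length)
    (hi : i ∈ instrTerm C.width (C.width + 4 * C.width * k) (C.instrAt k)) :
    k = (i / C.width - 1) / 4 := by
  obtain ⟨h₁, h₂, h₃, -⟩ := C.instrAt_bounds hk
  have key : ∀ r x, x < C.width → (C.width * r + x) / C.width = r := fun r x hx => by
    rw [Nat.mul_add_div (by omega), Nat.div_eq_of_lt hx, Nat.add_zero]
  simp only [instrTerm, List.mem_cons, List.not_mem_nil, or_false] at hi
  -- The factors lie in the rows 4k+1, 4k+2 and 4k+3, which no other instruction uses.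
  have hrow : ∃ r x, i = C.width * r + x ∧ x < C.width ∧ (r - 1) / 4 = k := by
    rcases hi with rfl | rfl | rfl
    · exact ⟨4 * k + 1, _, by ring, h₂, by omega⟩
    · exact ⟨4 * k + 2, _, by ring, h₁, by omega⟩
    · exact ⟨4 * k + 3, _, by ring, h₃, by omega⟩
  obtain ⟨r, x, rfl, hx, rfl⟩ := hrow
  rw [key r x hx]

theorem termLists_nodup : C.termLists.Nodup := by
  rw [termLists, instrTerms_instrs, List.nodup_append, List.nodup_reverse]
  refine ⟨List.Nodup.map_on ?_ List.nodup_range, List.Nodup.map_on ?_ List.nodup_range, ?_⟩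
  · intro a _ b _ h
    simp [linkTerm] at h
    omega
  · intro a ha b hb h
    rw [List.mem_range] at ha hb
    have h₁ := C.instrTerm_index ha (List.mem_cons_self ..)
    have h₂ := C.instrTerm_index (i := C.width + 4 * C.width * a +
      (C.instrAt a).2.1) hb (by rw [← h]; exact List.mem_cons_self ..)
    rw [h₁, ← h₂]
  · intro a ha b hb h
    simp only [List.mem_reverse, List.mem_map] at ha hb
    obtain ⟨d, -, rfl⟩ := ha
    obtain ⟨k, -, rfl⟩ := hb
    -- A link has two factors and an instruction three.
    simp [linkTerm, instrTerm] at h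

/-- At most one link to the row below, one to the row above, and one instruction. -/
theorem length_filter_termLists_le (i : ℕ) :
    (C.termLists.filter fun t => i ∈ t).length ≤ 3 := by
  rw [termLists, List.filter_append, List.length_append, List.filter_reverse, List.length_reverse,
    instrTerms_instrs, List.filter_map, List.filter_map, List.length_map, List.length_map]
  have h₁ : ((List.range C.numLinks).filter ((fun t => decide (i ∈ t)) ∘
      linkTerm C.width (C.numInputs + 2))).length ≤ 2 := by
    rw [← List.toFinset_card_of_nodup (List.nodup_range.filter _)]
    -- The indices of the links in which `i` is the first or the second endpoint. Truncated
    -- subtraction is harmless, as only an inclusion is needed.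
    refine (Finset.card_le_card (t := {i - (C.numInputs + 2), i - (C.numInputs + 2 + C.width)})
      fun d hd => ?_).trans Finset.card_le_two
    simp [linkTerm] at hd ⊢
    omega
  have h₂ : ((List.range C.instrs.length).filter ((fun t => decide (i ∈ t)) ∘
      fun k => instrTerm C.width (C.width + 4 * C.width * k)
        (C.instrAt k))).length ≤ 1 := by
    rw [← List.toFinset_card_of_nodup (List.nodup_range.filter _)]
    refine (Finset.card_le_card (t := {(i / C.width - 1) / 4})
      fun d hd => ?_).trans (Finset.card_singleton _).le
    rw [List.mem_toFinset, List.mem_filter, List.mem_range] at hd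
    rw [Finset.mem_singleton]
    exact C.instrTerm_index hd.1 (by simpa using hd.2)
  omega

instance neZero_polyVars : NeZero C.polyVars := ⟨Nat.succ_ne_zero _⟩

/-- The polynomial of a circuit. -/
noncomputable abbrev toPolyF2 : PolyF2 :=
  PolyF2.ofLists C.polyVars C.termLists (fun _ => C.termLists_sorted)
    (fun _ ht _ => C.termLists_lt ht) C.termLists_nodup

theorem encode_toPolyF2 :
    C.toPolyF2.encode = encUnary C.polyVars ++ encList (encList encUnary) C.termLists :=
  PolyF2.encode_ofLists _ _ _

/-- The polynomial of a circuit has degree three, and every variable appears in at most three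
terms. -/
noncomputable def toCubic : CubicThreeTerms :=
  ⟨C.toPolyF2, by
    refine PolyF2.totalDegree_ofLists _ _ _ 3 (fun t ht => ?_) ?_
    · rcases (C.mem_termLists).1 ht with ⟨d, hd, rfl⟩ | ⟨k, hk, rfl⟩ <;> simp [linkTerm, instrTerm]
    · exact ⟨_, (C.mem_termLists).2 (.inr ⟨0, C.instrs_length_pos, rfl⟩), rfl⟩,
   fun i => (PolyF2.numTermsWith_ofLists_le _ _ _ i).trans (C.length_filter_termLists_le i)⟩

end Circuit

open Reduction Reduction.Stk in
/-- The polynomial of a circuit is computable in polynomial time. -/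
theorem polyTime_toCubic {α : Type} {ea : α → List Bool} {f : α → Circuit}
    (hf : PolyTime ea Circuit.encode f) :
    PolyTime ea (fun P : CubicThreeTerms => P.1.encode) (fun a => (f a).toCubic) := by
  refine hf.andThen program (some O)
    (400 * (4 * Polynomial.X ^ 2 + 3 * Polynomial.X + 2) ^ 2) fun C => ?_
  obtain ⟨n, hn, hr⟩ := runsIn_program C
  refine ⟨n, hn.trans ?_, ?_⟩
  · have := C.polyVars_le
    simp only [Polynomial.eval_mul, Polynomial.eval_pow, Polynomial.eval_add, Polynomial.eval_X,
      Polynomial.eval_ofNat]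
    exact Nat.mul_le_mul_left _ (Nat.pow_le_pow_left (by rw [Circuit.width] at this; omega) 2)
  · convert hr using 1
    · funext k
      rcases k with _ | k
      · rfl
      · cases k <;> rfl
    · funext k
      refine (congrArg (fun l => Function.update (fun _ => []) (some O) l k)
        C.encode_toPolyF2).trans ?_
      rcases k with _ | k
      · rfl
      · cases k <;> rfl

/-! ### Extracting the count from the gap -/

/-- Half of the odd part of a number, rounded down. -/
def oddPartHalf (n : ℕ) : ℕ := ordCompl[2] n / 2

/-- Remove the leading zeroes and the first one. -/
def dropFirstOne : List Bool → List Bool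
  | [] => []
  | false :: l => dropFirstOne l
  | true :: l => l

/-- The code starts with the least significant bit. Zero is excluded because its code is empty. -/
theorem encodeNat_bit0 {n : ℕ} (hn : n ≠ 0) :
    Computability.encodeNat (2 * n) = false :: Computability.encodeNat n := by
  have h : ((2 * n : ℕ) : Num) = (n : Num).bit0 := by
    rw [← Num.bit0_of_bit0, two_mul, Nat.cast_add]
  have h0 : (n : Num) ≠ 0 := by exact_mod_cast hn
  rw [Computability.encodeNat, Computability.encodeNat, h]
  cases hp : (n : Num) with
  | zero => exact absurd hp h0
  | pos p => rfl

theorem encodeNat_bit1 (n : ℕ) :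
    Computability.encodeNat (2 * n + 1) = true :: Computability.encodeNat n := by
  have h : ((2 * n + 1 : ℕ) : Num) = (n : Num).bit1 := by
    rw [← Num.bit1_of_bit1, two_mul, Nat.cast_add, Nat.cast_add, Nat.cast_one]
  rw [Computability.encodeNat, Computability.encodeNat, h]
  cases hp : (n : Num) with
  | zero => rfl
  | pos p => rfl

theorem oddPartHalf_two_pow_mul (a b : ℕ) : oddPartHalf (2 ^ a * (2 * b + 1)) = b := by
  rw [oddPartHalf, Nat.ordCompl_mul, Nat.ordCompl_self_pow Nat.prime_two, one_mul,
    Nat.factorization_eq_zero_of_not_dvd (by omega : ¬ 2 ∣ 2 * b + 1), pow_zero, Nat.div_one]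
  omega

/-- The leading zeroes of the code are the factors of two, and the first one is the lowest bit of
the odd part; dropping it halves the odd part, rounded down. -/
theorem encodeNat_oddPartHalf (n : ℕ) :
    Computability.encodeNat (oddPartHalf n) = dropFirstOne (Computability.encodeNat n) := by
  induction n using Nat.strong_induction_on with
  | _ n ih =>
    rcases Nat.even_or_odd' n with ⟨m, rfl | rfl⟩
    · rcases eq_or_ne m 0 with rfl | hm
      · simp [oddPartHalf]
        rfl
      · rw [encodeNat_bit0 hm, dropFirstOne, ← ih m (by omega)]
        rw [oddPartHalf, oddPartHalf, Nat.ordCompl_mul]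
        congr 2
        rw [Nat.Prime.factorization_self Nat.prime_two]
        simp
    · rw [encodeNat_bit1, dropFirstOne]
      congr 1
      simpa using oddPartHalf_two_pow_mul 0 m

namespace Extraction

open Cmd Function

/-- Skip the string and the sign, and halve the odd part of the number. -/
def program : Cmd (Option Empty) :=
  seq (loop none id fun _ => branch none fun _ => skip)
    (seq (branch none fun _ => skip) (loop none (fun b => !b) fun _ => skip))

/-- The loop pops the marker of an item and the `branch` its bit; the closing zero ends the loop and
is popped as well. -/
theorem runsIn_skipString (l rest : List Bool) :
    RunsIn (loop none id fun _ => branch none fun _ => skip)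
      (fun _ : Option Empty => encList (fun b => [b]) l ++ rest) (fun _ => rest)
      (3 * l.length + 1) := by
  induction l with
  | nil =>
    refine (RunsIn.loop_done (by simp [encList])).cast ?_
    funext k
    cases k
    · simp [encList]
    · contradiction
  | cons b l ih =>
    refine (RunsIn.loop_step (b := true) (n₁ := 1 + 1) (n₂ := 3 * l.length + 1)
      (l := b :: (encList (fun b => [b]) l ++ rest)) (by simp [encList]) rfl
      (RunsIn.branch ((RunsIn.skip _).cast ?_)) ih).mono (by simp; omega)
    funext k
    cases k
    · simp
    · contradiction

/-- The bit that fails the test of a loop is popped too, and here this is the first one. -/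
theorem runsIn_dropFirstOne (l : List Bool) :
    RunsIn (loop none (fun b => !b) fun _ => skip) (fun _ : Option Empty => l)
      (fun _ => dropFirstOne l) (2 * l.length + 1) := by
  induction l with
  | nil =>
    refine (RunsIn.loop_done (by simp)).cast ?_
    funext k
    cases k
    · simp [dropFirstOne]
    · contradiction
  | cons b l ih =>
    cases b with
    | true =>
      refine ((RunsIn.loop_done (by simp)).mono (by omega)).cast ?_
      funext k
      cases k
      · simp [dropFirstOne]
      · contradiction
    | false =>
      refine (RunsIn.loop_step (k := none) (s := fun _ => false :: l) (b := false) (n₁ := 1) (n₂ := 2 * l.length + 1) (l := l) rfl rfl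
        ((RunsIn.skip _).cast ?_) ih).mono (by simp; omega)
      funext k
      cases k
      · exact Function.update_self ..
      · contradiction

end Extraction

-- The identity machine leaves the code on its output stack, and the program works there in place,
-- so no additional stacks are needed. The string component is discarded.
open Cmd in
theorem polyTime_oddPartHalf :
    PolyTime encStringInt Computability.encodeNat (fun p => oddPartHalf p.2.natAbs) := by
  refine PolyTime.andThen (f := id)
    (g := fun p : List Bool × ℤ => oddPartHalf p.2.natAbs) ⟨Turing.idComputableInPolyTime encStringInt⟩
    Extraction.program none (5 * Polynomial.X + 5) fun p => ?_
  obtain ⟨l, z⟩ := p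
  have e : ∀ l : List Bool,
      Function.update (fun _ : Option Empty => []) none l = fun _ => l := by
    intro l
    funext k
    cases k
    · simp
    · contradiction
  rw [e, e, encodeNat_oddPartHalf]
  have h₁ := Extraction.runsIn_skipString l (encInt z)
  have h₂ : RunsIn (branch none fun _ => skip) (fun _ : Option Empty => encInt z)
      (fun _ => Computability.encodeNat z.natAbs) (1 + 1) := by
    refine RunsIn.branch ((RunsIn.skip _).cast ?_)
    funext k
    cases k
    · simp [encInt]
    · contradiction
  have h₃ := Extraction.runsIn_dropFirstOne (Computability.encodeNat z.natAbs)
  have h₄ : 2 * l.length + 1 ≤ (encList (fun b => [b]) l).length :=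
    length_encList_ge _ 1 l fun _ => le_rfl
  obtain ⟨n, hn, hr⟩ := h₁.seq (h₂.seq h₃)
  refine ⟨n, hn.trans ?_, hr⟩
  simp only [Polynomial.eval_add, Polynomial.eval_mul, Polynomial.eval_X, Polynomial.eval_ofNat,
    encStringInt, List.length_append, encInt, List.length_cons]
  omega

/-! ### Sums of signs -/

/-- The sign `(-1) ^ a`. -/
def sgn (a : ZMod 2) : ℤ := (-1) ^ a.val

theorem sgn_add (a b : ZMod 2) : sgn (a + b) = sgn a * sgn b := by
  revert a b; decide

theorem sgn_sum {ι : Type*} (s : Finset ι) (f : ι → ZMod 2) :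
    sgn (∑ i ∈ s, f i) = ∏ i ∈ s, sgn (f i) := by
  classical
  induction s using Finset.induction_on with
  | empty => rfl
  | insert a s ha ih => rw [Finset.sum_insert ha, Finset.prod_insert ha, sgn_add, ih]

/-- Orthogonality of the characters of 𝔽₂. -/
theorem sum_sgn_mul (a : ZMod 2) : ∑ b : ZMod 2, sgn (b * a) = if a = 0 then 2 else 0 := by
  revert a; decide

/-- If the exponent is linear in some of the variables, then the sum of signs counts the
assignments of the other variables for which all coefficients vanish. -/
theorem sum_sgn_linear {V ι : Type*} [Fintype V] [DecidableEq V] (Y : V → Prop) [DecidablePred Y]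
    (T : Finset ι) (y : ι → V) (hy : ∀ t ∈ T, Y (y t)) (m : ι → ({i // ¬ Y i} → ZMod 2) → ZMod 2) :
    ∑ x : V → ZMod 2, sgn (∑ t ∈ T, x (y t) * m t fun i => x i) =
      2 ^ Fintype.card {i // Y i} * (Finset.univ.filter fun v : {i // ¬ Y i} → ZMod 2 =>
        ∀ j, Y j → ∑ t ∈ T, (if y t = j then m t v else 0) = 0).card := by
  rw [← (Equiv.piEquivPiSubtypeProd Y fun _ => ZMod 2).symm.sum_comp, Fintype.sum_prod_type_right,
    Finset.card_filter, Nat.cast_sum, Finset.mul_sum]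
  refine Finset.sum_congr rfl fun v _ => ?_
  have h₁ : ∀ u : {i // Y i} → ZMod 2,
      sgn (∑ t ∈ T, (Equiv.piEquivPiSubtypeProd Y fun _ => ZMod 2).symm (u, v) (y t) *
        m t fun i => (Equiv.piEquivPiSubtypeProd Y fun _ => ZMod 2).symm (u, v) i) =
      ∏ j : {i // Y i}, sgn (u j * ∑ t ∈ T, if y t = j then m t v else 0) := by
    intro u
    -- The terms are grouped by their distinguished variable `y t`.
    rw [← sgn_sum]
    congr 1
    simp_rw [Finset.mul_sum]
    rw [Finset.sum_comm]
    refine Finset.sum_congr rfl fun t ht => ?_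
    rw [Finset.sum_eq_single ⟨y t, hy t ht⟩]
    · rw [if_pos rfl, Equiv.piEquivPiSubtypeProd_symm_apply, dif_pos (hy t ht)]
      congr 2
      funext i
      exact dif_neg i.2
    · intro j _ hj
      rw [if_neg fun h => hj (Subtype.ext h.symm), mul_zero]
    · simp
  -- For fixed `v` the sum over `u` of a product over `j` is a product of sums over single
  -- variables, each equal to 2 or 0.
  rw [Finset.sum_congr rfl fun u _ => h₁ u, ← Fintype.piFinset_univ,
    ← Finset.prod_univ_sum (fun _ : {i // Y i} => Finset.univ)
      (fun (j : {i // Y i}) b => sgn (b * ∑ t ∈ T, if y t = (j : V) then m t v else 0))]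
  simp_rw [sum_sgn_mul]
  rw [Finset.prod_ite_zero]
  simp

/-! ### Rows of variables -/

/-- The effect of an instruction on the columns. -/
def Instr.apply (o : Instr) (h : ℕ → ZMod 2) : ℕ → ZMod 2 :=
  Function.update h o.1 (h o.1 + h o.2.1 * h o.2.2)

/-- The columns after the first `k` instructions. -/
def stateAt (o : ℕ → Instr) (s : ℕ → ZMod 2) : ℕ → ℕ → ZMod 2
  | 0 => s
  | k + 1 => (o k).apply (stateAt o s k)

/-- Extend a vector by zero. -/
def pad {c : ℕ} (s : Fin c → ZMod 2) (p : ℕ) : ZMod 2 := if h : p < c then s ⟨p, h⟩ else 0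

theorem sum_range_ite_add_eq (D c j : ℕ) (a : ZMod 2) :
    ∑ d ∈ Finset.range D, (if d + c = j then a else 0) = if c ≤ j ∧ j < c + D then a else 0 := by
  by_cases h : c ≤ j
  · rw [Finset.sum_congr rfl fun d _ => if_congr (show d + c = j ↔ d = j - c by omega) rfl rfl,
      Finset.sum_ite_eq']
    exact if_congr (by rw [Finset.mem_range]; omega) rfl rfl
  · rw [if_neg fun h' => h h'.1]
    exact Finset.sum_eq_zero fun d _ => if_neg (by omega)

section rows

variable {w c K : ℕ} {o : ℕ → Instr}

theorem mul_add_div_self {r p : ℕ} (hp : p < w) : (w * r + p) / w = r := by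
  rw [Nat.mul_add_div (by omega), Nat.div_eq_of_lt hp, Nat.add_zero]

theorem mul_add_inj {r r' p p' : ℕ} (hp : p < w) (hp' : p' < w) :
    w * r + p = w * r' + p' ↔ r = r' ∧ p = p' := by
  constructor
  · intro h
    have hr : r = r' := by
      have := congrArg (· / w) h
      simpa only [mul_add_div_self hp, mul_add_div_self hp'] using this
    subst hr
    exact ⟨rfl, by omega⟩
  · rintro ⟨rfl, rfl⟩
    rfl

/-- The coefficient of a variable in an even row that stems from the links between the rows. -/
theorem sum_links (X : ℕ → ZMod 2) (D j : ℕ) (hw : 0 < w) (hj : j / w % 2 = 0) :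
    ∑ d ∈ Finset.range D, (if (if (d + c) / w % 2 = 0 then d + c else d + (c + w)) = j then
        (if (d + c) / w % 2 = 0 then X (d + (c + w)) else X (d + c)) else 0) =
      (if c ≤ j ∧ j < c + D then X (j + w) else 0) +
        (if c + w ≤ j ∧ j < c + w + D then X (j - w) else 0) := by
  rw [← sum_range_ite_add_eq, ← sum_range_ite_add_eq, ← Finset.sum_add_distrib]
  refine Finset.sum_congr rfl fun d _ => ?_
  -- The ends of a link lie in consecutive rows, so exactly one of them is in an even row.
  have hdiv : (d + (c + w)) / w = (d + c) / w + 1 := by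
    rw [← Nat.add_assoc, Nat.add_div_right _ hw]
  by_cases h : (d + c) / w % 2 = 0
  · simp only [if_pos h]
    have h' : d + (c + w) ≠ j := by
      rintro rfl
      omega
    rw [if_neg h', add_zero]
    by_cases h'' : d + c = j
    · rw [if_pos h'', if_pos h'', ← h'', Nat.add_assoc]
    · rw [if_neg h'', if_neg h'']
  · simp only [if_neg h]
    have h' : d + c ≠ j := by
      rintro rfl
      omega
    rw [if_neg h', zero_add]
    by_cases h'' : d + (c + w) = j
    · rw [if_pos h'', if_pos h'', ← h'', ← Nat.add_assoc, Nat.add_sub_cancel]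
    · rw [if_neg h'', if_neg h'']

/-- The coefficient of a variable that stems from the instructions. -/
theorem sum_instrs (X : ℕ → ZMod 2) (ho : ∀ k < K, (o k).1 < w) {r p : ℕ} (hp : p < w) :
    ∑ k ∈ Finset.range K, (if w + 4 * w * k + (w + (o k).1) = w * r + p then
        X (w + 4 * w * k + (o k).2.1) * X (w + 4 * w * k + (w + (w + (o k).2.2))) else 0) =
      if r % 4 = 2 ∧ r / 4 < K ∧ (o (r / 4)).1 = p then
        X (w * (4 * (r / 4) + 1) + (o (r / 4)).2.1) *
          X (w * (4 * (r / 4) + 3) + (o (r / 4)).2.2) else 0 := by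
  -- Only the target row of an instruction is even.
  have key : ∀ k < K, (w + 4 * w * k + (w + (o k).1) = w * r + p ↔ r = 4 * k + 2 ∧ (o k).1 = p) := by
    intro k hk
    rw [show w + 4 * w * k + (w + (o k).1) = w * (4 * k + 2) + (o k).1 by ring,
      mul_add_inj (ho k hk) hp, eq_comm]
  by_cases h : r % 4 = 2 ∧ r / 4 < K ∧ (o (r / 4)).1 = p
  · rw [if_pos h, Finset.sum_eq_single (r / 4)]
    · rw [if_pos ((key _ h.2.1).2 ⟨by omega, h.2.2⟩)]
      congr 2 <;> ring
    · intro k hk hne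
      rw [if_neg]
      rw [key k (Finset.mem_range.1 hk)]
      omega
    · intro hk
      exact absurd (Finset.mem_range.2 h.2.1) hk
  · rw [if_neg h]
    refine Finset.sum_eq_zero fun k hk => if_neg ?_
    rw [key k (Finset.mem_range.1 hk)]
    rintro ⟨rfl, h'⟩
    have hk' : (4 * k + 2) / 4 = k := by omega
    exact h ⟨by omega, by rw [hk']; exact Finset.mem_range.1 hk, by rw [hk']; exact h'⟩

/-- The constraints on the values in the odd rows. -/
structure Valid (w c K : ℕ) (o : ℕ → Instr) (X : ℕ → ZMod 2) : Prop where
  zero : ∀ p < w, c ≤ p → X (w * 1 + p) = 0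
  apply : ∀ k < K, ∀ p < w, X (w * (4 * k + 3) + p) = X (w * (4 * k + 1) + p) +
    if (o k).1 = p then X (w * (4 * k + 1) + (o k).2.1) * X (w * (4 * k + 3) + (o k).2.2) else 0
  copy : ∀ k < K, ∀ p < w, X (w * (4 * k + 5) + p) = X (w * (4 * k + 3) + p)
  final : ∀ p < c, X (w * (4 * K + 1) + p) = 0

/-- In characteristic two, a vanishing sum of the neighbours above and below is an equation between
odd rows: row 0 yields `zero`, the rows 4k+2 yield `apply`, the rows 4k+4 yield `copy`, and row 4K+2
yields `final`. Since the links start at column `c` of row 0, they end at column `c - 1` of row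
4K+2. The last variable, in column `c` of that row, is in no term and imposes nothing. -/
theorem constraints_iff_valid (hc : c < w) (ho : ∀ k < K, (o k).1 < w) (X : ℕ → ZMod 2) :
    (∀ j < c + (w + (w + 4 * w * K)) + 1, j / w % 2 = 0 →
      ∑ d ∈ Finset.range (w + 4 * w * K),
        (if (if (d + c) / w % 2 = 0 then d + c else d + (c + w)) = j then
          (if (d + c) / w % 2 = 0 then X (d + (c + w)) else X (d + c)) else 0) +
      ∑ k ∈ Finset.range K, (if w + 4 * w * k + (w + (o k).1) = j then
        X (w + 4 * w * k + (o k).2.1) * X (w + 4 * w * k + (w + (w + (o k).2.2))) else 0) = 0) ↔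
      Valid w c K o X := by
  have hw : 0 < w := by omega
  have e₁ : ∀ k p, w * (4 * k + 2) + p + w = w * (4 * k + 3) + p := fun k p => by ring
  have e₂ : ∀ k p, w * (4 * k + 2) + p - w = w * (4 * k + 1) + p := fun k p => by
    rw [← Nat.add_sub_cancel (n := w * (4 * k + 1) + p) (m := w)]; congr 1; ring
  have e₃ : ∀ k p, w * (4 * k + 4) + p + w = w * (4 * k + 5) + p := fun k p => by ring
  have e₄ : ∀ k p, w * (4 * k + 4) + p - w = w * (4 * k + 3) + p := fun k p => by
    rw [← Nat.add_sub_cancel (n := w * (4 * k + 3) + p) (m := w)]; congr 1; ring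
  have hlt : ∀ k < K, w * (4 * k + 4) ≤ 4 * w * K := fun k hk => by
    calc w * (4 * k + 4) = 4 * w * (k + 1) := by ring
      _ ≤ 4 * w * K := Nat.mul_le_mul_left _ hk
  have m₁ : ∀ k, w * (4 * k + 4) = w * (4 * k + 2) + 2 * w := fun k => by ring
  have m₂ : ∀ k, w * (4 * k + 2) = w * (4 * k) + 2 * w := fun k => by ring
  have m₃ : w * (4 * K + 2) = 4 * w * K + 2 * w := by ring
  have row₀ : ∀ p < w, (∑ d ∈ Finset.range (w + 4 * w * K),
        (if (if (d + c) / w % 2 = 0 then d + c else d + (c + w)) = p then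
          (if (d + c) / w % 2 = 0 then X (d + (c + w)) else X (d + c)) else 0) +
      ∑ k ∈ Finset.range K, (if w + 4 * w * k + (w + (o k).1) = p then
        X (w + 4 * w * k + (o k).2.1) * X (w + 4 * w * k + (w + (w + (o k).2.2))) else 0) = 
          if c ≤ p then X (w * 1 + p) else 0) := by
    intro p hp
    have h := sum_instrs (r := 0) (K := K) X ho hp
    rw [Nat.mul_zero, Nat.zero_add] at h
    rw [sum_links X _ p hw (by rw [Nat.div_eq_of_lt hp]), h, if_neg (by omega : ¬ (c + w ≤ p ∧ _)),
      if_neg (by omega : ¬ (0 % 4 = 2 ∧ _)), add_zero, add_zero, Nat.mul_one,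
      Nat.add_comm w p]
    exact if_congr (by omega) rfl rfl
  have row₂ : ∀ k < K, ∀ p < w, (∑ d ∈ Finset.range (w + 4 * w * K),
        (if (if (d + c) / w % 2 = 0 then d + c else d + (c + w)) = w * (4 * k + 2) + p then
          (if (d + c) / w % 2 = 0 then X (d + (c + w)) else X (d + c)) else 0) +
      ∑ k' ∈ Finset.range K, (if w + 4 * w * k' + (w + (o k').1) = w * (4 * k + 2) + p then
        X (w + 4 * w * k' + (o k').2.1) * X (w + 4 * w * k' + (w + (w + (o k').2.2))) else 0) = 
          X (w * (4 * k + 3) + p) + X (w * (4 * k + 1) + p) +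
          if (o k).1 = p then X (w * (4 * k + 1) + (o k).2.1) * X (w * (4 * k + 3) + (o k).2.2)
            else 0) := by
    intro k hk p hp
    have := hlt k hk
    have := m₁ k
    have := m₂ k
    have hk4 : (4 * k + 2) / 4 = k := by omega
    rw [sum_links X _ _ hw (by rw [mul_add_div_self hp]; omega), sum_instrs X ho hp, e₁, e₂, hk4,
      if_pos (by omega), if_pos (by omega)]
    congr 1
    exact if_congr (by omega) rfl rfl
  have row₄ : ∀ k < K, ∀ p < w, (∑ d ∈ Finset.range (w + 4 * w * K),
        (if (if (d + c) / w % 2 = 0 then d + c else d + (c + w)) = w * (4 * k + 4) + p then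
          (if (d + c) / w % 2 = 0 then X (d + (c + w)) else X (d + c)) else 0) +
      ∑ k' ∈ Finset.range K, (if w + 4 * w * k' + (w + (o k').1) = w * (4 * k + 4) + p then
        X (w + 4 * w * k' + (o k').2.1) * X (w + 4 * w * k' + (w + (w + (o k').2.2))) else 0) = 
          X (w * (4 * k + 5) + p) + X (w * (4 * k + 3) + p)) := by
    intro k hk p hp
    have := hlt k hk
    have := m₁ k
    have := m₂ k
    rw [sum_links X _ _ hw (by rw [mul_add_div_self hp]; omega), sum_instrs X ho hp, e₃, e₄,
      if_pos (by omega), if_pos (by omega), if_neg (by omega), add_zero]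
  have rowK : ∀ p < w, (∑ d ∈ Finset.range (w + 4 * w * K),
        (if (if (d + c) / w % 2 = 0 then d + c else d + (c + w)) = w * (4 * K + 2) + p then
          (if (d + c) / w % 2 = 0 then X (d + (c + w)) else X (d + c)) else 0) +
      ∑ k' ∈ Finset.range K, (if w + 4 * w * k' + (w + (o k').1) = w * (4 * K + 2) + p then
        X (w + 4 * w * k' + (o k').2.1) * X (w + 4 * w * k' + (w + (w + (o k').2.2))) else 0) = 
          if p < c then X (w * (4 * K + 1) + p) else 0) := by
    intro p hp
    rw [sum_links X _ _ hw (by rw [mul_add_div_self hp]; omega), sum_instrs X ho hp, e₂,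
      if_neg (by omega), if_neg (by omega : ¬ (_ ∧ (4 * K + 2) / 4 < K ∧ _)), add_zero, zero_add]
    exact if_congr (by omega) rfl rfl
  constructor
  · intro h
    refine ⟨fun p hp hcp => ?_, fun k hk p hp => ?_, fun k hk p hp => ?_, fun p hp => ?_⟩
    · have := h p (by omega) (by rw [Nat.div_eq_of_lt hp])
      rwa [row₀ p hp, if_pos hcp] at this
    · have h₁ := hlt k hk
      have h₂ := m₁ k
      have := h (w * (4 * k + 2) + p) (by omega) (by rw [mul_add_div_self hp]; omega)
      rw [row₂ k hk p hp, add_assoc] at this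
      exact CharTwo.add_eq_zero.1 this
    · have h₁ := hlt k hk
      have := h (w * (4 * k + 4) + p) (by omega) (by rw [mul_add_div_self hp]; omega)
      rw [row₄ k hk p hp] at this
      exact CharTwo.add_eq_zero.1 this
    · have := h (w * (4 * K + 2) + p) (by omega) (by rw [mul_add_div_self (by omega)]; omega)
      rwa [rowK p (by omega), if_pos hp] at this
  · intro h j hj hj2
    obtain ⟨r, p, hp, rfl⟩ : ∃ r p, p < w ∧ j = w * r + p :=
      ⟨j / w, j % w, Nat.mod_lt _ hw, (Nat.div_add_mod j w).symm⟩
    rw [mul_add_div_self hp] at hj2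
    have hr : r ≤ 4 * K + 2 := by
      by_contra hr
      have : w * (4 * K + 3) ≤ w * r := Nat.mul_le_mul_left _ (by omega)
      have : w * (4 * K + 3) = 4 * w * K + 3 * w := by ring
      omega
    rcases Nat.eq_zero_or_pos r with rfl | hr0
    · rw [Nat.mul_zero, Nat.zero_add, row₀ p hp]
      split_ifs with hcp
      · exact h.zero p hp hcp
      · rfl
    · rcases hr.eq_or_lt with rfl | hr'
      · rw [rowK p hp]
        split_ifs with hpc
        · exact h.final p hpc
        · rfl
      · rcases (by omega : r % 4 = 0 ∨ r % 4 = 2) with h4 | h4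
        · obtain ⟨k, rfl⟩ : ∃ k, r = 4 * k + 4 := ⟨r / 4 - 1, by omega⟩
          rw [row₄ k (by omega) p hp]
          exact CharTwo.add_eq_zero.2 (h.copy k (by omega) p hp)
        · obtain ⟨k, rfl⟩ : ∃ k, r = 4 * k + 2 := ⟨r / 4, by omega⟩
          rw [row₂ k (by omega) p hp, add_assoc]
          exact CharTwo.add_eq_zero.2 (h.apply k (by omega) p hp)

end rows

/-! ### Valid assignments as trajectories of the instructions -/

section trajectory

variable {w c K : ℕ} {o : ℕ → Instr} {X : ℕ → ZMod 2} {s : ℕ → ZMod 2}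

theorem stateAt_succ_of_ne {k p : ℕ} (h : p ≠ (o k).1) : stateAt o s (k + 1) p = stateAt o s k p :=
  Function.update_of_ne h ..

/-- The second factor is taken after the instruction, which did not change it; this matches the row
from which the cubic term reads it. -/
theorem stateAt_succ {k p : ℕ} (h : (o k).2.2 ≠ (o k).1) :
    stateAt o s (k + 1) p = stateAt o s k p +
      if (o k).1 = p then stateAt o s k (o k).2.1 * stateAt o s (k + 1) (o k).2.2 else 0 := by
  by_cases hp : (o k).1 = p
  · rw [if_pos hp, stateAt_succ_of_ne h, ← hp]
    exact Function.update_self ..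
  · rw [if_neg hp, add_zero, stateAt_succ_of_ne (Ne.symm hp)]

theorem Valid.rows (h : Valid w c K o X)
    (ho : ∀ k < K, (o k).1 < w ∧ (o k).2.1 < w ∧ (o k).2.2 < w ∧ (o k).2.2 ≠ (o k).1)
    (hs : ∀ p < w, X (w * 1 + p) = s p) :
    (∀ k ≤ K, ∀ p < w, X (w * (4 * k + 1) + p) = stateAt o s k p) ∧
      ∀ k < K, ∀ p < w, X (w * (4 * k + 3) + p) = stateAt o s (k + 1) p := by
  have step : ∀ k < K, (∀ p < w, X (w * (4 * k + 1) + p) = stateAt o s k p) →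
      ∀ p < w, X (w * (4 * k + 3) + p) = stateAt o s (k + 1) p := by
    intro k hk ih p hp
    obtain ⟨-, h₁, h₂, h₃⟩ := ho k hk
    -- The equation for row 4k+3 mentions that row itself in its second factor. It is used once more
    -- in that column, which is not the target and hence is just carried over.
    rw [stateAt_succ h₃, h.apply k hk p hp, ih p hp, ih _ h₁, h.apply k hk _ h₂,
      if_neg (Ne.symm h₃), add_zero, ih _ h₂, stateAt_succ_of_ne h₃]
  have one : ∀ k ≤ K, ∀ p < w, X (w * (4 * k + 1) + p) = stateAt o s k p := by
    intro k
    induction k with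
    | zero => exact fun _ => hs
    | succ k ih =>
      intro hk p hp
      rw [← step k hk (ih (Nat.le_of_succ_le hk)) p hp]
      exact h.copy k hk p hp
  exact ⟨one, fun k hk => step k hk (one k hk.le)⟩

theorem valid_of_rows (hc : c < w)
    (ho : ∀ k < K, (o k).1 < w ∧ (o k).2.1 < w ∧ (o k).2.2 < w ∧ (o k).2.2 ≠ (o k).1)
    (h₁ : ∀ k ≤ K, ∀ p < w, X (w * (4 * k + 1) + p) = stateAt o s k p)
    (h₃ : ∀ k < K, ∀ p < w, X (w * (4 * k + 3) + p) = stateAt o s (k + 1) p)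
    (hs : ∀ p, c ≤ p → s p = 0) (hK : ∀ p < c, stateAt o s K p = 0) : Valid w c K o X where
  zero p hp hcp := (h₁ 0 (Nat.zero_le _) p hp).trans (hs p hcp)
  apply k hk p hp := by
    obtain ⟨-, hi, hj, hne⟩ := ho k hk
    rw [h₃ k hk p hp, h₃ k hk _ hj, h₁ k hk.le p hp, h₁ k hk.le _ hi]
    exact stateAt_succ hne
  copy k hk p hp := (h₁ (k + 1) hk p hp).trans (h₃ k hk p hp).symm
  final p hp := (h₁ K le_rfl p (hp.trans hc)).trans (hK p hp)

/-- The values of the odd rows for given initial columns. -/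
def traj (o : ℕ → Instr) (s : ℕ → ZMod 2) (w m : ℕ) : ZMod 2 :=
  if m / w % 4 = 1 then stateAt o s (m / w / 4) (m % w) else stateAt o s (m / w / 4 + 1) (m % w)

theorem traj_one {k p : ℕ} (hp : p < w) : traj o s w (w * (4 * k + 1) + p) = stateAt o s k p := by
  rw [traj, mul_add_div_self hp, if_pos (by omega), Nat.mul_add_mod, Nat.mod_eq_of_lt hp]
  congr 1
  omega

theorem traj_three {k p : ℕ} (hp : p < w) :
    traj o s w (w * (4 * k + 3) + p) = stateAt o s (k + 1) p := by
  rw [traj, mul_add_div_self hp, if_neg (by omega), Nat.mul_add_mod, Nat.mod_eq_of_lt hp]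
  congr 1
  omega

/-- Extend an assignment of the odd rows by zero. -/
def extOdd (w : ℕ) {N : ℕ} (v : {i : Fin N // ¬ (i : ℕ) / w % 2 = 0} → ZMod 2) (m : ℕ) : ZMod 2 :=
  if h : m < N ∧ ¬ m / w % 2 = 0 then v ⟨⟨m, h.1⟩, h.2⟩ else 0

theorem extOdd_of_odd {N m : ℕ} (v : {i : Fin N // ¬ (i : ℕ) / w % 2 = 0} → ZMod 2) (hm : m < N)
    (h : ¬ m / w % 2 = 0) : extOdd w v m = v ⟨⟨m, hm⟩, h⟩ := dif_pos ⟨hm, h⟩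

open Classical in
/-- The valid assignments are the trajectories that end in zero. -/
theorem card_valid {N : ℕ} (hc : c < w)
    (ho : ∀ k < K, (o k).1 < w ∧ (o k).2.1 < w ∧ (o k).2.2 < w ∧ (o k).2.2 ≠ (o k).1)
    (hN : N = c + (w + (w + 4 * w * K)) + 1) :
    (Finset.univ.filter fun v : {i : Fin N // ¬ (i : ℕ) / w % 2 = 0} → ZMod 2 =>
      Valid w c K o (extOdd w v)).card =
    (Finset.univ.filter fun s : Fin c → ZMod 2 => ∀ p < c, stateAt o (pad s) K p = 0).card := by
  have hw : 0 < w := by omega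
  have hlt₁ : ∀ k ≤ K, ∀ p < w, w * (4 * k + 1) + p < N := fun k hk p hp => by
    have : w * (4 * k + 1) ≤ w * (4 * K + 1) := Nat.mul_le_mul_left _ (by omega)
    have : w * (4 * K + 1) = 4 * w * K + w := by ring
    omega
  have hlt₃ : ∀ k < K, ∀ p < w, w * (4 * k + 3) + p < N := fun k hk p hp => by
    have : w * (4 * k + 3) ≤ w * (4 * K + 1) := Nat.mul_le_mul_left _ (by omega)
    have : w * (4 * K + 1) = 4 * w * K + w := by ring
    omega
  have hodd₁ : ∀ k, ∀ p < w, ¬ (w * (4 * k + 1) + p) / w % 2 = 0 := fun k p hp => by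
    rw [mul_add_div_self hp]; omega
  have hodd₃ : ∀ k, ∀ p < w, ¬ (w * (4 * k + 3) + p) / w % 2 = 0 := fun k p hp => by
    rw [mul_add_div_self hp]; omega
  -- By `Valid.zero`, row 1 is determined by its first `c` entries.
  have hpad : ∀ v : {i : Fin N // ¬ (i : ℕ) / w % 2 = 0} → ZMod 2, Valid w c K o (extOdd w v) →
      ∀ p < w, extOdd w v (w * 1 + p) = pad (fun p : Fin c => extOdd w v (w * 1 + p)) p := by
    intro v hv p hp
    unfold pad
    split_ifs with h
    · rfl
    · exact hv.zero p hp (by omega)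
  have ext₁ : ∀ s : Fin c → ZMod 2, ∀ k ≤ K, ∀ p < w,
      extOdd w (fun i : {i : Fin N // ¬ (i : ℕ) / w % 2 = 0} => traj o (pad s) w i)
        (w * (4 * k + 1) + p) = stateAt o (pad s) k p := fun s k hk p hp =>
    (extOdd_of_odd _ (hlt₁ k hk p hp) (hodd₁ k p hp)).trans (traj_one hp)
  have ext₃ : ∀ s : Fin c → ZMod 2, ∀ k < K, ∀ p < w,
      extOdd w (fun i : {i : Fin N // ¬ (i : ℕ) / w % 2 = 0} => traj o (pad s) w i)
        (w * (4 * k + 3) + p) = stateAt o (pad s) (k + 1) p := fun s k hk p hp =>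
    (extOdd_of_odd _ (hlt₃ k hk p hp) (hodd₃ k p hp)).trans (traj_three hp)
  -- Restriction to the free columns of row 1, with the trajectory as inverse.
  refine Finset.card_nbij' (fun v p => extOdd w v (w * 1 + p)) (fun s i => traj o (pad s) w i)
    ?_ ?_ ?_ ?_
  · intro v hv
    simp only [Finset.coe_filter, Finset.mem_univ, true_and, Set.mem_ofPred_eq] at hv ⊢
    intro p hp
    rw [← (hv.rows ho (hpad v hv)).1 K le_rfl p (hp.trans hc)]
    exact hv.final p hp
  · intro s hs
    simp only [Finset.coe_filter, Finset.mem_univ, true_and, Set.mem_ofPred_eq] at hs ⊢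
    exact valid_of_rows hc ho (ext₁ s) (ext₃ s) (fun p hp => dif_neg (by omega)) hs
  · intro v hv
    simp only [Finset.coe_filter, Finset.mem_univ, true_and, Set.mem_ofPred_eq] at hv
    obtain ⟨h₁, h₃⟩ := hv.rows ho (hpad v hv)
    funext ⟨⟨m, hm⟩, hm2⟩
    obtain ⟨r, p, hp, rfl⟩ : ∃ r p, p < w ∧ m = w * r + p :=
      ⟨m / w, m % w, Nat.mod_lt _ hw, (Nat.div_add_mod m w).symm⟩
    have hr : r ≤ 4 * K + 2 := by
      by_contra hr
      have : w * (4 * K + 3) ≤ w * r := Nat.mul_le_mul_left _ (by omega)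
      have : w * (4 * K + 3) = 4 * w * K + 3 * w := by ring
      omega
    rw [← extOdd_of_odd v hm hm2]
    change traj _ _ w (w * r + p) = _
    have hr2 := hm2
    change ¬ (w * r + p) / w % 2 = 0 at hr2
    rw [mul_add_div_self hp] at hr2
    rcases (by omega : r % 4 = 1 ∨ r % 4 = 3) with h4 | h4
    · obtain ⟨k, rfl⟩ : ∃ k, r = 4 * k + 1 := ⟨r / 4, by omega⟩
      rw [traj_one hp, h₁ k (by omega) p hp]
    · obtain ⟨k, rfl⟩ : ∃ k, r = 4 * k + 3 := ⟨r / 4, by omega⟩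
      rw [traj_three hp, h₃ k (by omega) p hp]
  · intro s hs
    funext p
    have := ext₁ s 0 (Nat.zero_le _) p (p.2.trans hc)
    refine this.trans ?_
    exact dif_pos p.2

end trajectory

namespace Circuit

variable (C : Circuit)

theorem sum_map_range {M : Type*} [AddCommMonoid M] (f : ℕ → M) (n : ℕ) :
    ((List.range n).map f).sum = ∑ k ∈ Finset.range n, f k := by
  rw [Finset.sum_range, ← List.sum_ofFn, List.ofFn_eq_map, ← List.map_coe_finRange_eq_range,
    List.map_map]
  rfl

/-- Each term contains exactly one variable in an even row, so `sum_sgn_linear` applies with the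
even rows as linear variables. The exponent `a` is their number; its value is never needed. -/
theorem gap_toPolyF2 : ∃ a : ℕ, gap C.toPolyF2.toPoly = 2 ^ a *
    (Finset.univ.filter fun s : Fin (C.numInputs + 2) → ZMod 2 =>
      ∀ p < C.numInputs + 2, stateAt C.instrAt (pad s) C.instrs.length p = 0).card := by
  set w := C.width with hw_def
  set c := C.numInputs + 2 with hc_def
  set K := C.instrs.length with hK_def
  have hwid := C.width_ge
  have hc : c < w := by omega
  have hw : 0 < w := by omega
  have ho : ∀ k < K, _ := fun k hk => C.instrAt_bounds hk
  have hN : C.polyVars = c + (w + (w + 4 * w * K)) + 1 := rfl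
  have := C.neZero_polyVars
  have hrow : ∀ k < K, w + 4 * w * k + 4 * w ≤ w + 4 * w * K := fun k hk => C.instr_row_lt hk
  let Y : Fin C.polyVars → Prop := fun i => (i : ℕ) / w % 2 = 0
  have hlink : ∀ d < w + 4 * w * K, d + (c + w) < C.polyVars := fun d hd => by omega
  have hdiv : ∀ d, (d + (c + w)) / w = (d + c) / w + 1 := fun d => by
    rw [← Nat.add_assoc, Nat.add_div_right _ hw]
  have hof : ∀ m < C.polyVars, ((Fin.ofNat C.polyVars m : Fin _) : ℕ) = m := fun m hm =>
    Nat.mod_eq_of_lt hm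
  -- Terms are indexed by links on the left and instructions on the right. `y` selects the even-row
  -- variable of a term, and `m` is the product of its remaining variables.
  let y : ℕ ⊕ ℕ → Fin C.polyVars := Sum.elim
    (fun d => Fin.ofNat _ (if (d + c) / w % 2 = 0 then d + c else d + (c + w)))
    (fun k => Fin.ofNat _ (w + 4 * w * k + (w + (C.instrAt k).1)))
  let m : ℕ ⊕ ℕ → ({i // ¬ Y i} → ZMod 2) → ZMod 2 := fun t v => Sum.elim
    (fun d => if (d + c) / w % 2 = 0 then extOdd w v (d + (c + w)) else extOdd w v (d + c))
    (fun k => extOdd w v (w + 4 * w * k + (C.instrAt k).2.1) *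
      extOdd w v (w + 4 * w * k + (w + (w + (C.instrAt k).2.2)))) t
  have row : ∀ r p, p < w → (w * r + p) / w = r := fun r p hp => mul_add_div_self hp
  have e₁ : ∀ k p, w + 4 * w * k + p = w * (4 * k + 1) + p := fun k p => by ring
  have e₂ : ∀ k p, w + 4 * w * k + (w + p) = w * (4 * k + 2) + p := fun k p => by ring
  have e₃ : ∀ k p, w + 4 * w * k + (w + (w + p)) = w * (4 * k + 3) + p := fun k p => by ring
  have hy : ∀ t ∈ (Finset.range (w + 4 * w * K)).disjSum (Finset.range K), Y (y t) := by
    rintro (d | k) ht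
    · have hd := Finset.mem_range.1 (Finset.inl_mem_disjSum.1 ht)
      have := hlink d hd
      have h2 := hdiv d
      change ((Fin.ofNat C.polyVars _ : Fin _) : ℕ) / w % 2 = 0
      split_ifs with h
      · rwa [hof _ (by omega)]
      · rw [hof _ (by omega)]
        omega
    · have hk := Finset.mem_range.1 (Finset.inr_mem_disjSum.1 ht)
      have := hrow k hk
      have := ho k hk
      change ((Fin.ofNat C.polyVars _ : Fin _) : ℕ) / w % 2 = 0
      rw [hof _ (by omega), e₂, row _ _ this.1]
      omega
  have hext : ∀ (x : Fin C.polyVars → ZMod 2) (i : ℕ), i < C.polyVars → ¬ i / w % 2 = 0 →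
      extOdd w (fun i : {i // ¬ Y i} => x i) i = x (Fin.ofNat _ i) := by
    intro x i hi h
    rw [extOdd_of_odd _ hi h]
    exact congrArg x (Fin.ext (hof i hi).symm)
  have heval : ∀ x : Fin C.polyVars → ZMod 2, MvPolynomial.eval x C.toPolyF2.toPoly =
      ∑ t ∈ (Finset.range (w + 4 * w * K)).disjSum (Finset.range K),
        x (y t) * m t fun i => x i := by
    intro x
    refine (PolyF2.eval_ofLists _ _ _ x).trans ?_
    rw [termLists, instrTerms_instrs, List.map_append, List.sum_append, List.map_reverse,
      List.sum_reverse, List.map_map, List.map_map, sum_map_range, sum_map_range,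
      Finset.sum_disjSum]
    congr 1
    · refine Finset.sum_congr rfl fun d hd => ?_
      have h := hlink d (Finset.mem_range.1 hd)
      have h2 := hdiv d
      simp only [Function.comp_apply, linkTerm, List.map_cons, List.map_nil, List.prod_cons,
        List.prod_nil, mul_one, y, m, Sum.elim_inl]
      split_ifs with h3
      · rw [hext x _ h (by omega)]
      · rw [hext x _ (by omega) h3, mul_comm]
    · refine Finset.sum_congr rfl fun k hk => ?_
      have h := hrow k (Finset.mem_range.1 hk)
      obtain ⟨h₁, h₂, h₃, -⟩ := ho k (Finset.mem_range.1 hk)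
      simp only [Function.comp_apply, instrTerm, List.map_cons, List.map_nil, List.prod_cons,
        List.prod_nil, mul_one, y, m, Sum.elim_inr]
      rw [hext x _ (by omega) (by rw [e₁, row _ _ h₂]; omega),
        hext x _ (by omega) (by rw [e₃, row _ _ h₃]; omega)]
      ring
  refine ⟨Fintype.card {i // Y i}, ?_⟩
  have hgap : gap C.toPolyF2.toPoly = ∑ x : Fin C.polyVars → ZMod 2,
      sgn (∑ t ∈ (Finset.range (w + 4 * w * K)).disjSum (Finset.range K),
        x (y t) * m t fun i => x i) :=
    Finset.sum_congr rfl fun x _ => congrArg sgn (heval x)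
  rw [hgap, sum_sgn_linear Y _ y hy m, ← card_valid hc ho hN]
  refine congrArg (fun S => _ * ((Finset.card S : ℕ) : ℤ)) (Finset.ext fun v => ?_)
  simp only [Finset.mem_filter, Finset.mem_univ, true_and]
  rw [← constraints_iff_valid hc (fun k hk => (ho k hk).1) (extOdd w v), ← hN]
  have hval : ∀ i < C.polyVars, ∀ j : Fin C.polyVars, Fin.ofNat C.polyVars i = j ↔ i = j :=
    fun i hi j => by rw [Fin.ext_iff, hof i hi]
  have hcoef : ∀ j : Fin C.polyVars,
      ∑ t ∈ (Finset.range (w + 4 * w * K)).disjSum (Finset.range K),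
        (if y t = j then m t v else 0) = 
      ∑ d ∈ Finset.range (w + 4 * w * K),
        (if (if (d + c) / w % 2 = 0 then d + c else d + (c + w)) = j then
          (if (d + c) / w % 2 = 0 then extOdd w v (d + (c + w)) else extOdd w v (d + c)) else 0) +
      ∑ k ∈ Finset.range K, (if w + 4 * w * k + (w + (C.instrAt k).1) = j then
        extOdd w v (w + 4 * w * k + (C.instrAt k).2.1) *
          extOdd w v (w + 4 * w * k + (w + (w + (C.instrAt k).2.2))) else 0) := by
    intro j
    rw [Finset.sum_disjSum]
    congr 1
    · refine Finset.sum_congr rfl fun d hd => if_congr (hval _ ?_ j) rfl rfl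
      have := hlink d (Finset.mem_range.1 hd)
      split_ifs <;> omega
    · refine Finset.sum_congr rfl fun k hk => if_congr (hval _ ?_ j) rfl rfl
      have := hrow k (Finset.mem_range.1 hk)
      have := ho k (Finset.mem_range.1 hk)
      omega
  constructor
  · intro h j hj hj2
    exact (hcoef ⟨j, hj⟩).symm.trans (h ⟨j, hj⟩ hj2)
  · intro h j hj
    exact (hcoef j).trans (h j j.2 hj)

end Circuit

/-! ### The counted vectors -/

namespace Instr

/-- The effect of a list of instructions. -/
def run (l : List Instr) (h : ℕ → ZMod 2) : ℕ → ZMod 2 := l.foldl (fun h o => o.apply h) h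

theorem run_cons (o : Instr) (l : List Instr) (h : ℕ → ZMod 2) :
    run (o :: l) h = run l (o.apply h) := rfl

theorem run_append (l₁ l₂ : List Instr) (h : ℕ → ZMod 2) :
    run (l₁ ++ l₂) h = run l₂ (run l₁ h) := List.foldl_append

theorem run_singleton_apply (o : Instr) (h : ℕ → ZMod 2) (p : ℕ) :
    run [o] h p = if p = o.1 then h o.1 + h o.2.1 * h o.2.2 else h p :=
  Function.update_apply ..

theorem stateAt_getD (l : List Instr) (o : Instr) (s : ℕ → ZMod 2) {k : ℕ} (hk : k ≤ l.length) :
    stateAt (fun k => l.getD k o) s k = run (l.take k) s := by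
  induction k with
  | zero => rfl
  | succ k ih =>
    rw [stateAt, ih (by omega), List.take_succ_eq_append_getElem hk, run_append,
      List.getD_eq_getElem _ _ hk]
    rfl

theorem run_of_ne {l : List Instr} {p : ℕ} (hl : ∀ o ∈ l, p ≠ o.1) (h : ℕ → ZMod 2) :
    run l h p = h p := by
  induction l generalizing h with
  | nil => rfl
  | cons o l ih =>
    rw [run_cons, ih fun o' ho' => hl o' (List.mem_cons_of_mem _ ho')]
    exact Function.update_of_ne (hl o List.mem_cons_self) ..

/-- Instructions have no constant term. The zero vector is therefore always counted, which makes the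
final number odd. -/
theorem run_zero (l : List Instr) : run l 0 = 0 := by
  induction l with
  | nil => rfl
  | cons o l ih =>
    have : o.apply 0 = 0 := by
      funext p
      simp [apply, Function.update_apply]
    rw [run_cons, this, ih]

/-- Column 0 is never a target here, so every instruction multiplies by the same factor. -/
theorem run_erase (m : ℕ) (h : ℕ → ZMod 2) :
    run ((List.range m).map fun d => (d + 1, d + 1, 0)) h =
      fun p => if 0 < p ∧ p ≤ m then h p * (1 + h 0) else h p := by
  induction m with
  | zero =>
    funext p
    rw [if_neg (by omega)]
    rfl
  | succ m ih =>
    rw [List.range_succ, List.map_append, run_append, ih]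
    funext p
    rw [List.map_singleton, run_singleton_apply]
    dsimp only
    by_cases hp : p = m + 1
    · subst hp
      rw [if_pos rfl, if_neg (by omega), if_neg (by omega), if_pos (by omega)]
      ring
    · rw [if_neg hp]
      exact if_congr (by omega) rfl rfl

end Instr

/-- A bit as an element of the field with two elements. -/
def bit (b : Bool) : ZMod 2 := if b then 1 else 0

/-- The columns that hold the constant one, a free element and the values of the wires. -/
def columns (u : ZMod 2) (v : List Bool) : ℕ → ZMod 2
  | 0 => 1
  | 1 => u
  | i + 2 => bit (v.getD i false)

theorem columns_append (u : ZMod 2) (v : List Bool) (b : Bool) :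
    columns u (v ++ [b]) = Function.update (columns u v) (v.length + 2) (bit b) := by
  funext p
  match p with
  | 0 => rfl
  | 1 => rfl
  | i + 2 =>
    rw [Function.update_apply]
    split_ifs with h
    · obtain rfl : i = v.length := by omega
      simp [columns]
    · simp only [columns]
      rcases Nat.lt_or_ge i v.length with hi | hi
      · rw [List.getD_append _ _ _ _ hi]
      · rw [List.getD_eq_default _ _ hi, List.getD_eq_default _ _ (by simp; omega)]

/-- The column of the next wire is still zero, so adding products to it amounts to writing their
sum. -/
theorem columns_length (u : ZMod 2) (v : List Bool) : columns u v (v.length + 2) = 0 := by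
  simp [columns, bit]

-- Over 𝔽₂ the gates are ij, i + j + ij and 1 + i. The linear summands are products as well, since a
-- · a = a and column 0 holds 1.
open Instr in
theorem Gate.run_instrs (u : ZMod 2) (v : List Bool) {g : Gate} (hg : g.ReadsBelow v.length) :
    run (g.instrs (v.length + 2)) (columns u v) =
      columns u (v ++ [g.eval fun i => v.getD i false]) := by
  rw [columns_append]
  have h0 := columns_length u v
  have hw : ∀ i, columns u v (i + 2) = bit (v.getD i false) := fun _ => rfl
  have ne : ∀ {i}, i < v.length → i + 2 ≠ v.length + 2 := fun h => by omega
  cases g with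
  | and i j =>
    change Function.update _ _ _ = _
    dsimp only
    rw [h0, hw, hw, Gate.eval]
    congr 1
    cases v.getD i false <;> cases v.getD j false <;> decide
  | or i j =>
    simp only [Gate.instrs, run_cons, Instr.apply, Function.update_self, Function.update_idem,
      Function.update_of_ne (ne hg.1), Function.update_of_ne (ne hg.2), h0, hw, Gate.eval]
    change Function.update _ _ _ = _
    congr 1
    cases v.getD i false <;> cases v.getD j false <;> decide
  | not i =>
    have hg : i < v.length := hg
    simp only [Gate.instrs, run_cons, Instr.apply, Function.update_self, Function.update_idem,
      Function.update_of_ne (ne hg), h0, hw, Gate.eval]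
    change Function.update _ _ _ = _
    congr 1
    have : columns u v 0 = 1 := rfl
    rw [this]
    cases v.getD i false <;> decide

theorem run_gatesInstrs (u : ZMod 2) (v : List Bool) (gs : List Gate)
    (h : ∀ (k : ℕ) (hk : k < gs.length), (gs[k]).ReadsBelow (v.length + k)) :
    Instr.run (gatesInstrs (v.length + 2) gs) (columns u v) =
      columns u (gs.foldl (fun v g => v ++ [g.eval fun i => v.getD i false]) v) := by
  induction gs generalizing v with
  | nil => rfl
  | cons g gs ih =>
    have hg : g.ReadsBelow v.length := h 0 (by simp)
    rw [gatesInstrs, Instr.run_append, Gate.run_instrs u v hg, List.foldl_cons, ← ih]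
    · rw [List.length_append, List.length_singleton, Nat.add_right_comm]
    · intro k hk
      have := h (k + 1) (by simpa using hk)
      rw [List.length_append, List.length_singleton, Nat.add_assoc, Nat.add_comm 1]
      exact this

theorem pad_cons (n : ℕ) (u : ZMod 2) (x : Fin n → Bool) :
    pad (c := n + 2) (Fin.cons 1 (Fin.cons u fun i => bit (x i))) = columns u (List.ofFn x) := by
  funext p
  match p with
  | 0 => rfl
  | 1 => rfl
  | i + 2 =>
    simp only [pad, columns]
    split_ifs with h
    · have hi : i < n := by omega
      rw [List.getD_eq_getElem _ _ (by simpa using hi), List.getElem_ofFn]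
      rfl
    · rw [List.getD_eq_default _ _ (by simp; omega)]
      rfl

namespace Circuit

open Instr

variable (C : Circuit)

theorem length_wires (x : Fin C.numInputs → Bool) :
    (C.wires x).length = C.numInputs + C.gates.length := by
  have : ∀ (gs : List Gate) (v : List Bool),
      (gs.foldl (fun v g => v ++ [g.eval fun i => v.getD i false]) v).length =
        v.length + gs.length := by
    intro gs
    induction gs with
    | nil => intro v; rfl
    | cons g gs ih => intro v; rw [List.foldl_cons, ih]; simp; omega
  rw [wires, this, List.length_ofFn]

/-- The instructions that evaluate the circuit. -/
def evalInstrs : List Instr :=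
  gatesInstrs (C.numInputs + 2) C.gates ++ [(C.outCol, C.output + 2, C.output + 2)]

theorem run_evalInstrs (u : ZMod 2) (x : Fin C.numInputs → Bool) :
    run C.evalInstrs (columns u (List.ofFn x)) C.outCol = bit (C.eval x) := by
  have h := run_gatesInstrs u (List.ofFn x) C.gates (by rw [List.length_ofFn]; exact C.gates_wf)
  rw [List.length_ofFn] at h
  rw [evalInstrs, run_append, h]
  change Function.update _ C.outCol _ C.outCol = _
  rw [Function.update_self]
  have h₁ := columns_length u (C.wires x)
  rw [C.length_wires, Nat.add_right_comm] at h₁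
  change columns u (C.wires x) C.outCol + bit (C.eval x) * bit (C.eval x) = _
  change columns u (C.wires x) C.outCol = 0 at h₁
  rw [h₁]
  cases C.eval x <;> decide

theorem run_evalInstrs_of_lt (h : ℕ → ZMod 2) {p : ℕ} (hp : p < C.numInputs + 2) :
    run C.evalInstrs h p = h p := by
  refine run_of_ne (fun o ho => ?_) h
  rcases List.mem_append.1 ho with ho | ho
  · have := gatesInstrs_bounds _ _ C.gates_wf o ho
    omega
  · obtain rfl := List.mem_singleton.1 ho
    dsimp only [outCol]
    omega

/-- The copy of the output lies beyond the erased columns, so it survives even if the output wire is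
an input. Column 0 changes only after it has driven the erasure. -/
theorem run_instrs (h : ℕ → ZMod 2) {p : ℕ} (hp : p < C.numInputs + 2) :
    run C.instrs h p = if p = 0 then h 0 + run C.evalInstrs h C.outCol else h p * (1 + h 0) := by
  have e : C.instrs = C.evalInstrs ++ ((List.range (C.numInputs + 1)).map
      (fun d => (d + 1, d + 1, 0)) ++ [(0, C.outCol, C.outCol)]) := by
    rw [instrs, evalInstrs, List.append_assoc]
    rfl
  have hq : ¬ C.outCol ≤ C.numInputs + 1 := by rw [outCol]; omega
  rw [e, run_append, run_append, run_erase, run_singleton_apply]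
  dsimp only
  by_cases h0 : p = 0
  · rw [if_pos h0, if_pos h0, if_neg (by omega), if_neg (by omega),
      C.run_evalInstrs_of_lt h (by omega)]
    congr 1
    generalize run C.evalInstrs h C.outCol = a
    revert a
    decide
  · rw [if_neg h0, if_neg h0, if_pos (by omega), C.run_evalInstrs_of_lt h hp,
      C.run_evalInstrs_of_lt h (by omega)]

theorem stateAt_instrAt (s : ℕ → ZMod 2) :
    stateAt C.instrAt s C.instrs.length = run C.instrs s := by
  have := stateAt_getD C.instrs (0, 0, 0) s le_rfl
  rwa [List.take_length] at this

/-- If `s 0 = 0`, the erasure multiplies by 1, so the other columns must have been zero from the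
start. If `s 0 = 1`, it multiplies by 0, and what remains is that column 0 ends at 1 + `C.eval x` =
0; column 1 is unconstrained. -/
theorem good_iff (s : Fin (C.numInputs + 2) → ZMod 2) :
    (∀ p < C.numInputs + 2, stateAt C.instrAt (pad s) C.instrs.length p = 0) ↔
      s = 0 ∨ ∃ u x, C.eval x = true ∧ Fin.cons 1 (Fin.cons u fun i => bit (x i)) = s := by
  rw [C.stateAt_instrAt]
  constructor
  · intro h
    have h0 : s 0 = 0 ∨ s 0 = 1 := by
      generalize s 0 = a
      revert a
      decide
    have hpad : ∀ p (hp : p < C.numInputs + 2), pad s p = s ⟨p, hp⟩ := fun p hp => dif_pos hp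
    rcases h0 with h0 | h0
    · left
      funext p
      by_cases hp : p = 0
      · rw [hp, h0]; rfl
      · have := h p p.2
        rw [C.run_instrs _ p.2, if_neg (by simpa using Fin.val_ne_of_ne hp), hpad p p.2,
          hpad 0 (by omega)] at this
        have h0' : s ⟨0, by omega⟩ = 0 := h0
        rwa [h0', add_zero, mul_one] at this
    · right
      have hs : Fin.cons 1 (Fin.cons (s 1) fun i : Fin C.numInputs =>
          bit (decide (s i.succ.succ = 1))) = s := by
        funext p
        refine Fin.cases h0.symm (fun p => ?_) p
        refine Fin.cases rfl (fun p => ?_) p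
        change bit (decide (s p.succ.succ = 1)) = s p.succ.succ
        generalize s p.succ.succ = a
        revert a
        decide
      refine ⟨s 1, _, ?_, hs⟩
      have := h 0 (by omega)
      rw [C.run_instrs _ (by omega), if_pos rfl, ← hs, pad_cons, run_evalInstrs] at this
      change 1 + _ = (0 : ZMod 2) at this
      revert this
      cases C.eval _
      · decide
      · exact fun _ => rfl
  · rintro (rfl | ⟨u, x, hx, rfl⟩) p hp
    · have : pad (0 : Fin (C.numInputs + 2) → ZMod 2) = 0 := by
        funext p
        simp [pad]
      rw [this, run_zero]
      rfl
    · rw [C.run_instrs _ hp, pad_cons, run_evalInstrs, hx]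
      change (if p = 0 then (1 : ZMod 2) + 1 else _ * (1 + 1)) = 0
      rw [CharTwo.add_self_eq_zero, mul_zero, ite_self]

/-- In the parametrisation `F`, `none` is the zero vector, and the factor `ZMod 2` is the dummy
column, which doubles the count. -/
theorem card_good : (Finset.univ.filter fun s : Fin (C.numInputs + 2) → ZMod 2 =>
    ∀ p < C.numInputs + 2, stateAt C.instrAt (pad s) C.instrs.length p = 0).card =
      2 * C.count + 1 := by
  have hbit : Function.Injective bit := by decide
  let F : Option (ZMod 2 × {x : Fin C.numInputs → Bool // C.eval x = true}) →
      Fin (C.numInputs + 2) → ZMod 2 := fun t =>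
    t.elim 0 fun t => Fin.cons 1 (Fin.cons t.1 fun i => bit (t.2.1 i))
  have hF : Function.Injective F := by
    rintro (_ | ⟨u, x, hx⟩) (_ | ⟨u', x', hx'⟩) h
    · rfl
    · exact absurd (congrFun h 0) (by change ¬ (0 : ZMod 2) = 1; decide)
    · exact absurd (congrFun h 0) (by change ¬ (1 : ZMod 2) = 0; decide)
    · have hu : u = u' := congrFun h 1
      have hx : x = x' := funext fun i => hbit (congrFun h i.succ.succ)
      subst hu hx
      rfl
  have himage : (Finset.univ.filter fun s : Fin (C.numInputs + 2) → ZMod 2 =>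
      ∀ p < C.numInputs + 2, stateAt C.instrAt (pad s) C.instrs.length p = 0) =
        Finset.univ.map ⟨F, hF⟩ := by
    ext s
    simp only [Finset.mem_filter, Finset.mem_univ, true_and, C.good_iff s, Finset.mem_map,
      Function.Embedding.coeFn_mk]
    constructor
    · rintro (rfl | ⟨u, x, hx, rfl⟩)
      · exact ⟨none, rfl⟩
      · exact ⟨some (u, ⟨x, hx⟩), rfl⟩
    · rintro ⟨_ | ⟨u, x, hx⟩, rfl⟩
      · exact Or.inl rfl
      · exact Or.inr ⟨u, x, hx, rfl⟩
  rw [himage, Finset.card_map, Finset.card_univ, Fintype.card_option, Fintype.card_prod, ZMod.card]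
  rfl

/-- The odd part of the gap is 2 · `count` + 1 for every exponent of two, so the extraction needs
neither the exponent nor the original input. -/
theorem oddPartHalf_gap : oddPartHalf (gap C.toPolyF2.toPoly).natAbs = C.count := by
  obtain ⟨a, ha⟩ := C.gap_toPolyF2
  rw [C.card_good] at ha
  have h : gap C.toPolyF2.toPoly = ((2 ^ a * (2 * C.count + 1) : ℕ) : ℤ) := by
    rw [ha]
    push_cast
    rfl
  rw [h, Int.natAbs_natCast, oddPartHalf_two_pow_mul]

end Circuit

theorem proposition3 :
    SharpPHard (fun P : CubicThreeTerms => P.1.encode) (fun P => gap P.1.toPoly) := by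
  rintro f ⟨C, hC, hf⟩
  exact ⟨fun x => (C x).toCubic, fun p => oddPartHalf p.2.natAbs, polyTime_toCubic hC,
    polyTime_oddPartHalf, fun x => (hf x).trans (C x).oddPartHalf_gap.symm⟩
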